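/- For $z\in\mathbb{C}\setminus[1,\infty)$ let ${}_2F_1(a,b;c;z)$ be the analytic continuation of the Gauss hypergeometric series. For $x>1$ let $$P^\mu_\nu(x)=\frac{1}{\Gamma(1-\mu)}\left(\frac{x+1}{x-1}\right)^{\mu/2}{}_2F_1\left(-\nu,1+\nu;1-\mu;\frac{1-x}{2}\right)$$ be the associated Legendre function of the first kind, and for $\omega>0$ let $$P^\mu_\nu(x,\omega)=\sqrt{\frac{2}{\pi}}\,\frac{\Gamma(1/2-\mu)\,(x^2-1)^{-\mu/2}}{\Gamma(1+\nu-\mu)\,\Gamma(-\nu-\mu)}\int_0^\omega\frac{\cosh(t(\nu+1/2))}{(\cosh t+x)^{1/2-\mu}}\,dt$$ be the incomplete Legendre integral. **Theorem 1.** Let $\mu\in\mathbb{C}$ with $\mathrm{Re}\,\mu<1/2$ and let $(a_n)_{n\ge1}$ be a sequence of complex numbers with $\sum_{n\ge1}|a_n|<\infty$. Then for every $n\in\mathbb{N}=\{1,2,\dots\}$ $$a_n=\frac{n}{\pi}\sinh(\pi n)\,\Gamma\left(\tfrac12+in-\mu\right)\Gamma\left(\tfrac12-in-\mu\right)\int_1^\infty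 P^\mu_{in-1/2}(x,\pi)\sum_{m=1}^\infty a_m P^\mu_{im-1/2}(x)\,dx .$$ The iterated series and integral converge absolutely: $\sum_{m\ge1}|a_mP^\mu_{im-1/2}(x)|<\infty$ for every $x>1$, and for every $n\in\mathbb{N}$ $$\int_1^\infty \left|P^\mu_{in-1/2}(x,\pi)\right|\sum_{m=1}^\infty\left|a_mP^\mu_{im-1/2}(x)\right|dx<\infty .$$ -/

import Mathlib

open Set MeasureTheory

noncomputable section

/-- The complex plane cut along `[1, ∞)`. -/
def cutPlane : Set ℂ := {z | 1 - z ∈ Complex.slitPlane}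

/-- `f` is an analytic continuation of the Gauss hypergeometric series `₂F₁(a, b; c; ·)` from the
unit disc to the plane cut along `[1, ∞)`. -/
def IsGaussContinuation (a b c : ℂ) (f : ℂ → ℂ) : Prop :=
  DifferentiableOn ℂ f cutPlane ∧
    ∀ z : ℂ, ‖z‖ < 1 → f z = ordinaryHypergeometric a b c z

open Classical in
/-- The Gauss hypergeometric function `₂F₁(a, b; c; z)` on the plane cut along `[1, ∞)`: the
(unique) analytic continuation of the hypergeometric series. -/
def gauss2F1 (a b c z : ℂ) : ℂ :=
  if h : ∃ f : ℂ → ℂ, IsGaussContinuation a b c f then h.choose z else 0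

/-- The associated Legendre function of the first kind `P^μ_ν(x)`, for real `x > 1`:
`Γ(1-μ)⁻¹ ((x+1)/(x-1))^{μ/2} ₂F₁(-ν, 1+ν; 1-μ; (1-x)/2)`. -/
def legendreP (μ ν : ℂ) (x : ℝ) : ℂ :=
  1 / Complex.Gamma (1 - μ) * (((x + 1) / (x - 1) : ℝ) : ℂ) ^ (μ / 2) *
    gauss2F1 (-ν) (1 + ν) (1 - μ) ((1 - (x : ℂ)) / 2)

/-- The incomplete Legendre integral `P^μ_ν(x, ω)`, for real `x > 1` and `ω > 0`. -/
def incompleteLegendreP (μ ν : ℂ) (x ω : ℝ) : ℂ :=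
  ((Real.sqrt (2 / Real.pi) : ℝ) : ℂ) *
    (Complex.Gamma (1 / 2 - μ) * ((x ^ 2 - 1 : ℝ) : ℂ) ^ (-μ / 2) /
      (Complex.Gamma (1 + ν - μ) * Complex.Gamma (-ν - μ))) *
    ∫ t in (0 : ℝ)..ω,
      Complex.cosh ((t : ℂ) * (ν + 1 / 2)) / ((Real.cosh t + x : ℝ) : ℂ) ^ (1 / 2 - μ)

end

/-! The functions `P^μ_{in-1/2}(x,π)` and `P^μ_{im-1/2}(x)` are biorthogonal on `(1,∞)`, so
integrating the series term by term isolates `a_n`. The biorthogonality reduces to that of sines on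
`(0,π)`. The complete function has the Mehler–Dirichlet form `legendreP_eq_mehler`: up to a constant
and the factor `(x²-1)^{μ/2}` it is `∫ cos(τu) (x - cosh u)_+^{-μ-1/2} du`. This comes from
`₂F₁(½-iτ, ½+iτ; ½; sin²θ) = cosh(2τθ)/cos θ`, continued to the cut plane, and Bateman's integral,
which raises the third parameter from `½` to `1-μ`. In the incomplete function an integration by
parts (`incompleteLegendreP_eq`) gives, up to a constant and `(x²-1)^{-μ/2}`, `∫₀^π sin(nt) sinh t
(x + cosh t)^{μ-3/2} dt`. In the product the powers of `x²-1` cancel, and Fubini leaves three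
explicit integrals: over `x` it is `1/((½-μ)(cosh t + cosh u))` (`integral_cpow_mul_cpow`), over `u`
the cosine transform `π sin(mt)/sinh(πm)` (`integral_cos_mul_sinh_div`), over `t` the orthogonality
of sines. Replacing sine and cosine by `1` in absolute value gives an integrable majorant
independent of `m`; with `∑|a_m| < ∞` this yields absolute convergence and the exchange of sum and
integral. -/

/-! ### Gauss series and the elementary case `c = 1/2`. -/

/-- The parameters for which the hypergeometric series has radius of convergence one. -/
def NotNonposInt (a : ℂ) : Prop := ∀ k : ℕ, (k : ℂ) ≠ -a

lemma notNonposInt_of_re_pos {a : ℂ} (ha : 0 < a.re) : NotNonposInt a := by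
  intro k hk
  have := congrArg Complex.re hk
  simp at this
  have hk0 : (0 : ℝ) ≤ k := Nat.cast_nonneg k
  linarith

lemma hasFPowerSeriesOnBall_hypergeometric {a b c : ℂ} (ha : NotNonposInt a)
    (hb : NotNonposInt b) (hc : NotNonposInt c) :
    HasFPowerSeriesOnBall (ordinaryHypergeometric a b c) (ordinaryHypergeometricSeries ℂ a b c)
      0 1 := by
  have hr := ordinaryHypergeometricSeries_radius_eq_one ℂ a b c
    fun k => ⟨ha k, hb k, hc k⟩
  have := FormalMultilinearSeries.hasFPowerSeriesOnBall
    (p := ordinaryHypergeometricSeries ℂ a b c) (by rw [hr]; exact one_pos)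
  rwa [hr] at this

lemma mem_eball_of_norm_lt_one {z : ℂ} (hz : ‖z‖ < 1) : z ∈ Metric.eball (0 : ℂ) 1 := by
  rw [Metric.mem_eball, edist_zero_right, ← ofReal_norm]
  exact ENNReal.ofReal_lt_one.2 hz

lemma hasSum_hypergeometric {a b c : ℂ} (ha : NotNonposInt a)
    (hb : NotNonposInt b) (hc : NotNonposInt c) {z : ℂ} (hz : ‖z‖ < 1) :
    HasSum (fun n => ordinaryHypergeometricCoefficient a b c n * z ^ n)
      (ordinaryHypergeometric a b c z) := by
  have h := (hasFPowerSeriesOnBall_hypergeometric ha hb hc).hasSum (y := z) (mem_eball_of_norm_lt_one hz)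
  simpa [ordinaryHypergeometricSeries, FormalMultilinearSeries.ofScalars_apply_eq, mul_comm]
    using h

lemma differentiableAt_hypergeometric {a b c : ℂ} (ha : NotNonposInt a)
    (hb : NotNonposInt b) (hc : NotNonposInt c) {z : ℂ} (hz : ‖z‖ < 1) :
    DifferentiableAt ℂ (ordinaryHypergeometric a b c : ℂ → ℂ) z :=
  ((hasFPowerSeriesOnBall_hypergeometric ha hb hc).analyticAt_of_mem
    (mem_eball_of_norm_lt_one hz)).differentiableAt

lemma hasSum_deriv_hypergeometric {a b c : ℂ} (ha : NotNonposInt a)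
    (hb : NotNonposInt b) (hc : NotNonposInt c) {z : ℂ} (hz : ‖z‖ < 1) :
    HasSum (fun n : ℕ => ((n : ℂ) + 1) * ordinaryHypergeometricCoefficient a b c (n + 1) * z ^ n)
      (deriv (ordinaryHypergeometric a b c) z) := by
  have h := (hasFPowerSeriesOnBall_hypergeometric ha hb hc).fderiv.hasSum (y := z)
    (mem_eball_of_norm_lt_one hz)
  have h1 := (ContinuousLinearMap.apply ℂ ℂ (1 : ℂ)).hasSum h
  rw [zero_add] at h1
  convert! h1 using 1
  ext n
  have : ((ordinaryHypergeometricSeries ℂ a b c).derivSeries n fun _ => z) 1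
      = z ^ n * (ordinaryHypergeometricSeries ℂ a b c).derivSeries.coeff n 1 := by
    rw [FormalMultilinearSeries.apply_eq_pow_smul_coeff]; simp
  simp only [ContinuousLinearMap.apply_apply]
  rw [this, FormalMultilinearSeries.derivSeries_coeff_one, ordinaryHypergeometricSeries,
    FormalMultilinearSeries.coeff_ofScalars]
  simp
  ring

lemma hasSum_mul_deriv_hypergeometric {a b c : ℂ} (ha : NotNonposInt a)
    (hb : NotNonposInt b) (hc : NotNonposInt c) {z : ℂ} (hz : ‖z‖ < 1) :
    HasSum (fun n : ℕ => (n : ℂ) * ordinaryHypergeometricCoefficient a b c n * z ^ n)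
      (z * deriv (ordinaryHypergeometric a b c) z) := by
  rw [← hasSum_nat_add_iff' 1]
  simp only [Finset.range_one, Finset.sum_singleton, Nat.cast_zero, zero_mul, sub_zero]
  convert! (hasSum_deriv_hypergeometric ha hb hc hz).mul_left z using 1
  ext n
  push_cast
  ring

lemma hypergeometricCoefficient_succ (a b c : ℂ) (n : ℕ) :
    ordinaryHypergeometricCoefficient a b c (n + 1) =
      ordinaryHypergeometricCoefficient a b c n * ((a + n) * (b + n)) / ((c + n) * (n + 1)) := by
  simp only [ordinaryHypergeometricCoefficient, ascPochhammer_succ_eval, Nat.factorial_succ,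
    Nat.cast_mul, mul_inv]
  push_cast
  rw [div_eq_mul_inv, mul_inv]
  ring

lemma hypergeometricCoefficient_three_halves (a b : ℂ) (n : ℕ) :
    (2 * n + 1) * ordinaryHypergeometricCoefficient a b (3 / 2) n =
      ordinaryHypergeometricCoefficient a b (1 / 2) n := by
  have hne : (2 * n + 1 : ℂ) ≠ 0 := by exact_mod_cast Nat.succ_ne_zero (2 * n)
  have key : ∀ k : ℕ, (ascPochhammer ℂ k).eval (3 / 2 : ℂ) =
      (2 * k + 1) * (ascPochhammer ℂ k).eval (1 / 2 : ℂ) := by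
    intro k
    induction k with
    | zero => simp
    | succ k ih =>
      rw [ascPochhammer_succ_eval, ascPochhammer_succ_eval, ih]
      push_cast
      ring
  simp only [ordinaryHypergeometricCoefficient, key, mul_inv]
  field_simp

/-- The operator `1 + 2z d/dz` multiplies the coefficient of `z^n` by `2n+1`, and `(3/2)_n = (2n+1)
(1/2)_n`. -/
lemma hypergeometric_half_eq {a b : ℂ} (ha : NotNonposInt a) (hb : NotNonposInt b) {z : ℂ}
    (hz : ‖z‖ < 1) :
    ordinaryHypergeometric a b (3 / 2) z + 2 * z * deriv (ordinaryHypergeometric a b (3 / 2)) z =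
      ordinaryHypergeometric a b (1 / 2) z := by
  have h1 : NotNonposInt (1 / 2) := notNonposInt_of_re_pos (by norm_num)
  have h3 : NotNonposInt (3 / 2) := notNonposInt_of_re_pos (by norm_num)
  refine HasSum.unique ?_ (hasSum_hypergeometric ha hb h1 hz)
  convert! (hasSum_hypergeometric ha hb h3 hz).add
    ((hasSum_mul_deriv_hypergeometric ha hb h3 hz).mul_left 2) using 1
  · ext n
    rw [← hypergeometricCoefficient_three_halves]
    ring
  · ring

/-- Since `(a+n)(b+n) = (n+½)² + τ²`, the recursion at `c = ½` leaves only `4τ²/(2n+1)` times the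
`n`-th coefficient. With `hypergeometric_half_eq` this gives a first-order system for the pair `c =
½`, `c = 3/2`, in place of the second-order hypergeometric equation. -/
lemma deriv_hypergeometric_half_eq {a b τ : ℂ} (ha : NotNonposInt a) (hb : NotNonposInt b)
    (hab : a + b = 1) (hab' : a * b = 1 / 4 + τ ^ 2) {z : ℂ} (hz : ‖z‖ < 1) :
    2 * (1 - z) * deriv (ordinaryHypergeometric a b (1 / 2)) z -
      ordinaryHypergeometric a b (1 / 2) z = 4 * τ ^ 2 * ordinaryHypergeometric a b (3 / 2) z := by
  have h1 : NotNonposInt (1 / 2) := notNonposInt_of_re_pos (by norm_num)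
  have h3 : NotNonposInt (3 / 2) := notNonposInt_of_re_pos (by norm_num)
  refine HasSum.unique ?_ ((hasSum_hypergeometric ha hb h3 hz).mul_left (4 * τ ^ 2))
  convert! (((hasSum_deriv_hypergeometric ha hb h1 hz).mul_left 2).sub
    ((hasSum_mul_deriv_hypergeometric ha hb h1 hz).mul_left 2)).sub
    (hasSum_hypergeometric ha hb h1 hz) using 1
  · ext n
    have hne : (n + 1 : ℂ) ≠ 0 := by exact_mod_cast Nat.succ_ne_zero n
    have hne' : (1 + 2 * n : ℂ) ≠ 0 := by
      rw [add_comm]; exact_mod_cast Nat.succ_ne_zero (2 * n)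
    have e : (a + n) * (b + n) = n ^ 2 + n + 1 / 4 + τ ^ 2 := by
      linear_combination hab' + n * hab
    rw [hypergeometricCoefficient_succ, e, show (1 / 2 + n : ℂ) = (1 + 2 * n) / 2 by ring, ← hypergeometricCoefficient_three_halves]
    field_simp
    ring
  · ring

/-- Put `C = cos θ · F_{1/2}(sin²θ)` and `S = sin θ · F_{3/2}(sin²θ)`. The two relations above say
`C' = 4τ² S` and `S' = C`, so `C + κS = e^{κθ}` for `κ = ±2τ`; the mean of the two is the claim. -/
lemma cos_mul_hypergeometric_sin_sq {a b : ℂ} {τ : ℝ} (ha : NotNonposInt a)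
    (hb : NotNonposInt b) (hab : a + b = 1) (hab' : a * b = 1 / 4 + (τ : ℂ) ^ 2) {θ : ℝ}
    (hθ : θ ∈ Ioo (-(Real.pi / 2)) (Real.pi / 2)) :
    (Real.cos θ : ℂ) * ordinaryHypergeometric a b (1 / 2) ((Real.sin θ : ℂ) ^ 2) =
      Real.cosh (2 * τ * θ) := by
  have h1 : NotNonposInt (1 / 2) := notNonposInt_of_re_pos (by norm_num)
  have h3 : NotNonposInt (3 / 2) := notNonposInt_of_re_pos (by norm_num)
  have hnorm : ∀ t ∈ Ioo (-(Real.pi / 2)) (Real.pi / 2), ‖((Real.sin t : ℂ)) ^ 2‖ < 1 := by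
    intro t ht
    have hc := Real.cos_pos_of_mem_Ioo ht
    have := Real.sin_sq_add_cos_sq t
    rw [← Complex.ofReal_pow, Complex.norm_real, Real.norm_eq_abs, abs_of_nonneg (sq_nonneg _)]
    nlinarith
  have hsin : ∀ t : ℝ, HasDerivAt (fun t : ℝ => (Real.sin t : ℂ)) (Real.cos t) t :=
    fun t => (Real.hasDerivAt_sin t).ofReal_comp
  have hcos : ∀ t : ℝ, HasDerivAt (fun t : ℝ => (Real.cos t : ℂ)) (-Real.sin t) t := by
    intro t
    simpa using (Real.hasDerivAt_cos t).ofReal_comp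
  have hcomp : ∀ c : ℂ, NotNonposInt c → ∀ t ∈ Ioo (-(Real.pi / 2)) (Real.pi / 2),
      HasDerivAt (fun t : ℝ => (ordinaryHypergeometric a b c ((Real.sin t : ℂ) ^ 2) : ℂ))
        (deriv (ordinaryHypergeometric a b c) ((Real.sin t : ℂ) ^ 2) *
          (2 * Real.sin t * Real.cos t)) t := by
    intro c hc t ht
    have hd := (differentiableAt_hypergeometric ha hb hc (hnorm t ht)).hasDerivAt
    have hs : HasDerivAt (fun t : ℝ => (Real.sin t : ℂ) ^ 2) (2 * Real.sin t * Real.cos t) t := by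
      simpa using! (hsin t).pow 2
    exact hd.comp t hs
  have hw : ∀ κ : ℝ, κ ^ 2 = 4 * τ ^ 2 → ∀ t ∈ Ioo (-(Real.pi / 2)) (Real.pi / 2),
      (Real.cos t : ℂ) * ordinaryHypergeometric a b (1 / 2) ((Real.sin t : ℂ) ^ 2) +
        κ * (Real.sin t * ordinaryHypergeometric a b (3 / 2) ((Real.sin t : ℂ) ^ 2)) =
      Real.exp (κ * t) := by
    intro κ hκ t ht
    set w : ℝ → ℂ := fun t => ((Real.cos t : ℂ) *
      ordinaryHypergeometric a b (1 / 2) ((Real.sin t : ℂ) ^ 2) +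
        κ * (Real.sin t * ordinaryHypergeometric a b (3 / 2) ((Real.sin t : ℂ) ^ 2))) *
        (Real.exp (-(κ * t)) : ℝ) with hwdef
    -- The function `(C + κS) e^{-κt}` is shown to be constant on the interval.
    have hder : ∀ t ∈ Ioo (-(Real.pi / 2)) (Real.pi / 2), HasDerivAt w 0 t := by
      intro t ht
      have hexp : HasDerivAt (fun t : ℝ => ((Real.exp (-(κ * t)) : ℝ) : ℂ))
          ((Real.exp (-(κ * t)) * (-κ) : ℝ)) t := by
        apply HasDerivAt.ofReal_comp
        have : HasDerivAt (fun t : ℝ => -(κ * t)) (-κ) t := by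
          simpa using! ((hasDerivAt_id t).const_mul κ).neg
        exact this.exp
      have := (((hcos t).fun_mul (hcomp _ h1 t ht)).fun_add
        (((hsin t).fun_mul (hcomp _ h3 t ht)).const_mul (κ : ℂ))).fun_mul hexp
      convert! this using 1
      have r1 := hypergeometric_half_eq ha hb (hnorm t ht)
      have r2 := deriv_hypergeometric_half_eq ha hb hab hab' (hnorm t ht)
      have hsc : (Real.sin t : ℂ) ^ 2 + (Real.cos t : ℂ) ^ 2 = 1 := by
        exact_mod_cast Real.sin_sq_add_cos_sq t
      have hκ' : (κ : ℂ) ^ 2 = 4 * (τ : ℂ) ^ 2 := by exact_mod_cast hκ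
      push_cast
      push_cast at r1 r2 hsc
      set S := Complex.sin t
      set C := Complex.cos t
      set F1 : ℂ := ordinaryHypergeometric a b (1 / 2) (S ^ 2)
      set F2 : ℂ := ordinaryHypergeometric a b (3 / 2) (S ^ 2)
      set D1 := deriv (ordinaryHypergeometric a b (1 / 2)) (S ^ 2)
      set D2 := deriv (ordinaryHypergeometric a b (3 / 2)) (S ^ 2)
      set E := Complex.exp (-(κ * t))
      linear_combination (-E * κ * C) * r1 - E * S * r2 + E * S * F2 * hκ' - 2 * E * S * D1 * hsc
    have hconst : w t = w 0 := by
      apply (isOpen_Ioo.is_const_of_deriv_eq_zero isPreconnected_Ioo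
        (fun s hs => (hder s hs).differentiableAt.differentiableWithinAt)
        (fun s hs => (hder s hs).deriv) ht)
      constructor <;> linarith [Real.pi_pos]
    have h0 : w 0 = 1 := by simp [hwdef]
    rw [h0, hwdef] at hconst
    simp only at hconst
    have hE : ((Real.exp (-(κ * t)) : ℝ) : ℂ) * (Real.exp (κ * t) : ℝ) = 1 := by
      rw [← Complex.ofReal_mul, ← Real.exp_add]; simp
    set X : ℂ := (Real.cos t : ℂ) * ordinaryHypergeometric a b (1 / 2) ((Real.sin t : ℂ) ^ 2) +
        κ * (Real.sin t * ordinaryHypergeometric a b (3 / 2) ((Real.sin t : ℂ) ^ 2))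
    calc X = X * (((Real.exp (-(κ * t)) : ℝ) : ℂ) * (Real.exp (κ * t) : ℝ)) := by rw [hE, mul_one]
      _ = (X * ((Real.exp (-(κ * t)) : ℝ) : ℂ)) * (Real.exp (κ * t) : ℝ) := by ring
      _ = _ := by rw [hconst, one_mul]
  have e1 := hw (2 * τ) (by ring) θ hθ
  have e2 := hw (-(2 * τ)) (by ring) θ hθ
  rw [Real.cosh_eq]
  push_cast at e1 e2 ⊢
  rw [show -(2 * (τ : ℂ) * θ) = -(2 * τ) * θ by ring]
  linear_combination (e1 + e2) / 2

/-! ### The closed form for `c = 1/2` on the cut plane. -/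

lemma cpow_half_sq (w : ℂ) : (w ^ (1 / 2 : ℂ)) ^ 2 = w := by
  simp [one_div]

lemma cpow_half_re_pos {w : ℂ} (hw : w ∈ Complex.slitPlane) : 0 < (w ^ (1 / 2 : ℂ)).re := by
  have harg : -Real.pi < w.arg ∧ w.arg < Real.pi :=
    ⟨Complex.neg_pi_lt_arg w, lt_of_le_of_ne (Complex.arg_le_pi w)
      (Complex.mem_slitPlane_iff_arg.1 hw).1⟩
  rw [Complex.cpow_def_of_ne_zero (Complex.slitPlane_ne_zero hw), Complex.exp_re]
  have him : (Complex.log w * (1 / 2)).im = w.arg / 2 := by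
    rw [show (1 / 2 : ℂ) = ((1 / 2 : ℝ) : ℂ) by push_cast; rfl, Complex.im_mul_ofReal,
      Complex.log_im]
    ring
  rw [him]
  refine mul_pos (Real.exp_pos _) (Real.cos_pos_of_mem_Ioo ⟨?_, ?_⟩) <;> linarith [harg.1, harg.2]

lemma eq_of_sq_eq_of_re_pos {v w : ℂ} (h : v ^ 2 = w ^ 2) (hv : 0 < v.re) (hw : 0 < w.re) :
    v = w := by
  rcases sq_eq_sq_iff_eq_or_eq_neg.1 h with h | h
  · exact h
  · rw [h, Complex.neg_re] at hv
    linarith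

/-- The numbers `v + is` and `v - is` are reciprocal with sum `2v`. Were one a nonpositive real, the
other would also have negative real part, against `0 < Re v`. -/
lemma add_I_mul_mem_slitPlane {v s : ℂ} (h : v ^ 2 + s ^ 2 = 1) (hv : 0 < v.re) :
    v + Complex.I * s ∈ Complex.slitPlane := by
  by_contra hp
  rw [Complex.mem_slitPlane_iff, not_or, not_lt, not_not] at hp
  have hpq : (v + Complex.I * s) * (v - Complex.I * s) = 1 := by
    linear_combination h - s ^ 2 * Complex.I_sq
  have hsum : (v + Complex.I * s) + (v - Complex.I * s) = 2 * v := by ring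
  set p := v + Complex.I * s
  set q := v - Complex.I * s
  have h1 := congrArg Complex.re hpq
  have h2 := congrArg Complex.re hsum
  simp only [Complex.mul_re, Complex.add_re, hp.2, zero_mul, sub_zero, Complex.one_re,
    Complex.re_ofNat, Complex.im_ofNat] at h1 h2
  nlinarith [hp.1]

/-- Changing the sign of `s` inverts `v + is`, hence negates its logarithm, and cosine is even. Thus
the choice of a square root of `z` is immaterial. -/
lemma cos_mul_log_symm {v s : ℂ} (κ : ℂ) (h : v ^ 2 + s ^ 2 = 1) (hv : 0 < v.re) :
    Complex.cos (κ * Complex.log (v + Complex.I * -s)) =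
      Complex.cos (κ * Complex.log (v + Complex.I * s)) := by
  have hpq : (v + Complex.I * s) * (v + Complex.I * -s) = 1 := by
    linear_combination h - s ^ 2 * Complex.I_sq
  rw [eq_inv_of_mul_eq_one_right hpq, Complex.log_inv _
    (Complex.mem_slitPlane_iff_arg.1 (add_I_mul_mem_slitPlane h hv)).1, mul_neg, Complex.cos_neg]

/-- The function `cosh (2 τ θ) / cos θ` of `z = sin² θ`, on the plane cut along `[1, ∞)`. -/
noncomputable def coshDivCos (τ : ℝ) (z : ℂ) : ℂ :=
  Complex.cos (2 * τ * Complex.log ((1 - z) ^ (1 / 2 : ℂ) + Complex.I * z ^ (1 / 2 : ℂ))) /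
    (1 - z) ^ (1 / 2 : ℂ)

lemma mem_cutPlane_iff_slitPlane {z : ℂ} : z ∈ cutPlane ↔ 1 - z ∈ Complex.slitPlane := Iff.rfl

lemma coshDivCos_eq {τ : ℝ} {z v s : ℂ} (hvz : v ^ 2 = 1 - z) (hv : 0 < v.re) (hs : s ^ 2 = z) :
    coshDivCos τ z = Complex.cos (2 * τ * Complex.log (v + Complex.I * s)) / v := by
  have hz : 1 - z ∈ Complex.slitPlane := by
    rw [← hvz, Complex.mem_slitPlane_iff]
    by_contra hcon
    rw [not_or, not_lt, not_not] at hcon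
    simp only [sq, Complex.mul_re, Complex.mul_im] at hcon
    have : v.im = 0 := by
      have := hcon.2
      have h2 : v.re * v.im = 0 := by linarith
      rcases mul_eq_zero.1 h2 with h | h
      · linarith
      · exact h
    rw [this] at hcon
    nlinarith [hcon.1]
  have e : (1 - z) ^ (1 / 2 : ℂ) = v :=
    eq_of_sq_eq_of_re_pos (by rw [cpow_half_sq, hvz]) (cpow_half_re_pos hz) hv
  have hone : v ^ 2 + s ^ 2 = 1 := by rw [hvz, hs]; ring
  rw [coshDivCos, e]
  rcases sq_eq_sq_iff_eq_or_eq_neg.1 (show (z ^ (1 / 2 : ℂ)) ^ 2 = s ^ 2 by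
    rw [cpow_half_sq, hs]) with h | h
  · rw [h]
  · rw [h, cos_mul_log_symm _ hone hv]

lemma isOpen_cutPlane : IsOpen cutPlane :=
  Complex.isOpen_slitPlane.preimage (by fun_prop : Continuous fun z : ℂ => 1 - z)

lemma zero_mem_cutPlane : (0 : ℂ) ∈ cutPlane := by simp [mem_cutPlane_iff_slitPlane]

lemma ofReal_mul_mem_cutPlane {z : ℂ} (hz : z ∈ cutPlane) {s : ℝ} (hs : s ∈ Icc (0 : ℝ) 1) :
    (s : ℂ) * z ∈ cutPlane := by
  rw [mem_cutPlane_iff_slitPlane] at *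
  have := Complex.starConvex_one_slitPlane.add_smul_sub_mem hz hs.1 hs.2
  convert! this using 1
  rw [Complex.real_smul]
  ring

lemma isPreconnected_cutPlane : IsPreconnected cutPlane := by
  have : StarConvex ℝ 0 cutPlane := by
    refine starConvex_zero_iff.2 fun z hz s hs0 hs1 => ?_
    rw [Complex.real_smul]
    exact ofReal_mul_mem_cutPlane hz ⟨hs0, hs1⟩
  exact (this.isPathConnected zero_mem_cutPlane).isConnected.isPreconnected

lemma mem_cutPlane_of_norm_lt_one {z : ℂ} (hz : ‖z‖ < 1) : z ∈ cutPlane := by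
  rw [mem_cutPlane_iff_slitPlane, Complex.mem_slitPlane_iff]
  left
  have := Complex.re_le_norm z
  simp
  linarith

lemma differentiableAt_cos_log {τ : ℝ} {z : ℂ} (hz : z ∈ cutPlane) {s : ℂ → ℂ}
    (hs : DifferentiableAt ℂ s z) (hsz : s z ^ 2 = z) :
    DifferentiableAt ℂ (fun z => Complex.cos (2 * τ * Complex.log
      ((1 - z) ^ (1 / 2 : ℂ) + Complex.I * s z)) / (1 - z) ^ (1 / 2 : ℂ)) z := by
  have hv : DifferentiableAt ℂ (fun z : ℂ => (1 - z) ^ (1 / 2 : ℂ)) z :=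
    DifferentiableAt.cpow (by fun_prop) (by fun_prop) hz
  have hpos := cpow_half_re_pos hz
  refine DifferentiableAt.div ?_ hv fun h => by rw [h] at hpos; simp at hpos
  refine ((DifferentiableAt.clog (hv.add (hs.const_mul _)) ?_).const_mul _).ccos
  exact add_I_mul_mem_slitPlane (by rw [cpow_half_sq, hsz]; ring) hpos

/-- The cut of `√z` along the negative axis is spurious: there `i√(-z)` serves as a holomorphic root
with the same value of the function. At `0`, where no holomorphic root exists, continuity makes the
singularity removable. -/
lemma differentiableOn_coshDivCos (τ : ℝ) : DifferentiableOn ℂ (coshDivCos τ) cutPlane := by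
  have main : ∀ z ∈ cutPlane, z ≠ 0 → DifferentiableAt ℂ (coshDivCos τ) z := by
    intro z hz h0
    by_cases hsl : z ∈ Complex.slitPlane
    · exact differentiableAt_cos_log hz
        (DifferentiableAt.cpow differentiableAt_id (by fun_prop) hsl) (cpow_half_sq z)
    · have hneg : -z ∈ Complex.slitPlane := by
        rw [Complex.mem_slitPlane_iff] at hsl ⊢
        rw [not_or, not_lt, not_not] at hsl
        left
        rcases lt_or_eq_of_le hsl.1 with h | h
        · simpa using h
        · exact absurd (Complex.ext h hsl.2) h0
      have hsq : ∀ w : ℂ, (Complex.I * (-w) ^ (1 / 2 : ℂ)) ^ 2 = w := by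
        intro w
        rw [mul_pow, cpow_half_sq, Complex.I_sq]
        ring
      refine (differentiableAt_cos_log (τ := τ) hz (s := fun w => Complex.I * (-w) ^ (1 / 2 : ℂ))
        ((DifferentiableAt.cpow (by fun_prop) (by fun_prop) hneg).const_mul _)
        (hsq z)).congr_of_eventuallyEq ?_
      filter_upwards [isOpen_cutPlane.mem_nhds hz] with w hw
      exact coshDivCos_eq (cpow_half_sq _) (cpow_half_re_pos hw) (hsq w)
  intro z hz
  by_cases h0 : z = 0
  · subst h0
    refine (Complex.analyticAt_of_differentiable_on_punctured_nhds_of_continuousAt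
      ?_ ?_).differentiableAt.differentiableWithinAt
    · filter_upwards [mem_nhdsWithin_of_mem_nhds (isOpen_cutPlane.mem_nhds hz),
        self_mem_nhdsWithin] with w hw hw0
      exact main w hw hw0
    · have hv : ContinuousAt (fun z : ℂ => (1 - z) ^ (1 / 2 : ℂ)) 0 :=
        (DifferentiableAt.cpow (by fun_prop) (by fun_prop) hz).continuousAt
      have hs : ContinuousAt (fun z : ℂ => z ^ (1 / 2 : ℂ)) 0 :=
        Complex.continuousAt_cpow_const_of_re_pos (by simp) (by norm_num)
      have hpos := cpow_half_re_pos hz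
      refine ContinuousAt.div ?_ hv fun h => by rw [h] at hpos; simp at hpos
      refine Complex.continuous_cos.continuousAt.comp
        (continuousAt_const.mul (ContinuousAt.clog (hv.add (continuousAt_const.mul hs)) ?_))
      exact add_I_mul_mem_slitPlane (by rw [cpow_half_sq, cpow_half_sq]; ring) hpos
  · exact (main z hz h0).differentiableWithinAt

lemma coshDivCos_sin_sq (τ : ℝ) {θ : ℝ} (hθ : θ ∈ Ioo (-(Real.pi / 2)) (Real.pi / 2)) :
    coshDivCos τ ((Real.sin θ : ℂ) ^ 2) = Real.cosh (2 * τ * θ) / Real.cos θ := by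
  have hc := Real.cos_pos_of_mem_Ioo hθ
  rw [coshDivCos_eq (v := (Real.cos θ : ℂ)) (s := (Real.sin θ : ℂ)) ?_ (by rwa [Complex.ofReal_re]) rfl]
  · have : (Real.cos θ : ℂ) + Complex.I * Real.sin θ = Complex.exp (θ * Complex.I) := by
      rw [Complex.exp_mul_I]; push_cast; ring
    rw [this, Complex.log_exp (by simpa using by linarith [hθ.1, Real.pi_pos])
      (by simpa using by linarith [hθ.2, Real.pi_pos]),
      show 2 * (τ : ℂ) * (θ * Complex.I) = (2 * τ * θ) * Complex.I by ring, Complex.cos_mul_I]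
    push_cast
    rfl
  · rw [eq_sub_iff_add_eq]
    exact_mod_cast Real.cos_sq_add_sin_sq θ

/-- For `z = -sinh²(u/2)` one may take `s = i sinh(u/2)`, so that `v + is = e^{-u/2}`. These are the
arguments met for `x > 1`. -/
lemma coshDivCos_neg_sinh_sq (τ u : ℝ) :
    coshDivCos τ (-(Real.sinh (u / 2) : ℂ) ^ 2) = Real.cos (τ * u) / Real.cosh (u / 2) := by
  have hc := Real.cosh_pos (u / 2)
  rw [coshDivCos_eq (v := (Real.cosh (u / 2) : ℂ)) (s := Complex.I * (Real.sinh (u / 2) : ℂ)) ?_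
    (by rwa [Complex.ofReal_re]) (by rw [mul_pow, Complex.I_sq]; ring)]
  · have : (Real.cosh (u / 2) : ℂ) + Complex.I * (Complex.I * Real.sinh (u / 2)) =
        ((Real.exp (-(u / 2)) : ℝ) : ℂ) := by
      rw [← mul_assoc, Complex.I_mul_I, ← Real.cosh_sub_sinh]; push_cast; ring
    rw [this, ← Complex.ofReal_log (Real.exp_pos _).le, Real.log_exp,
      show 2 * (τ : ℂ) * ((-(u / 2) : ℝ) : ℂ) = -((τ * u : ℝ) : ℂ) by push_cast; ring,
      Complex.cos_neg, Complex.ofReal_cos]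
  · have := Real.cosh_sq (u / 2)
    rw [← Complex.ofReal_pow, this]
    push_cast
    ring

/-- Identity theorem on the unit disc: both sides agree on `(0,1)`, which accumulates at `0`. -/
lemma coshDivCos_eq_hypergeometric {a b : ℂ} {τ : ℝ} (ha : NotNonposInt a)
    (hb : NotNonposInt b) (hab : a + b = 1) (hab' : a * b = 1 / 4 + (τ : ℂ) ^ 2) {z : ℂ}
    (hz : ‖z‖ < 1) : coshDivCos τ z = ordinaryHypergeometric a b (1 / 2) z := by
  have h1 : NotNonposInt (1 / 2) := notNonposInt_of_re_pos (by norm_num)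
  have hA : AnalyticOnNhd ℂ (coshDivCos τ) (Metric.ball 0 1) :=
    ((differentiableOn_coshDivCos τ).mono fun w hw =>
      mem_cutPlane_of_norm_lt_one (by simpa using hw)).analyticOnNhd Metric.isOpen_ball
  have hB : AnalyticOnNhd ℂ (ordinaryHypergeometric a b (1 / 2)) (Metric.ball (0 : ℂ) 1) :=
    DifferentiableOn.analyticOnNhd (fun w hw => (differentiableAt_hypergeometric ha hb h1
      (by simpa using hw)).differentiableWithinAt) Metric.isOpen_ball
  refine hA.eqOn_of_preconnected_of_frequently_eq hB (convex_ball 0 1).isPreconnected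
    (Metric.mem_ball_self one_pos) ?_ (by simpa using hz)
  have hreal : ∀ x ∈ Ioo (0 : ℝ) 1, coshDivCos τ x = ordinaryHypergeometric a b (1 / 2) (x : ℂ) := by
    intro x hx
    set θ := Real.arcsin (√x) with hθ
    have hsx : √x < 1 := by rw [Real.sqrt_lt' one_pos]; simpa using hx.2
    have hsθ : Real.sin θ = √x :=
      Real.sin_arcsin (by linarith [Real.sqrt_nonneg x]) hsx.le
    have hmem : θ ∈ Ioo (-(Real.pi / 2)) (Real.pi / 2) :=
      ⟨Real.neg_pi_div_two_lt_arcsin.2 (by linarith [Real.sqrt_nonneg x]),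
        Real.arcsin_lt_pi_div_two.2 hsx⟩
    have hx' : (x : ℂ) = (Real.sin θ : ℂ) ^ 2 := by
      rw [hsθ, ← Complex.ofReal_pow, Real.sq_sqrt hx.1.le]
    have hc : (Real.cos θ : ℂ) ≠ 0 := by exact_mod_cast (Real.cos_pos_of_mem_Ioo hmem).ne'
    rw [hx', coshDivCos_sin_sq τ hmem, ← cos_mul_hypergeometric_sin_sq ha hb hab hab' hmem,
      mul_div_cancel_left₀ _ hc]
  -- The shift by `2` keeps every point, including that of `n = 0`, inside the open interval
  -- `(0,1)`.
  have htend : Filter.Tendsto (fun n : ℕ => (((1 / ((n : ℝ) + 2)) : ℝ) : ℂ)) Filter.atTop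
      (nhdsWithin 0 {0}ᶜ) := by
    refine tendsto_nhdsWithin_iff.2 ⟨?_, Filter.Eventually.of_forall fun n => ?_⟩
    · rw [← Complex.ofReal_zero]
      refine (Complex.continuous_ofReal.tendsto 0).comp ?_
      refine tendsto_const_nhds.div_atTop (Filter.tendsto_atTop_add_const_right _ _
        tendsto_natCast_atTop_atTop)
    · have : (0 : ℝ) < 1 / ((n : ℝ) + 2) := by positivity
      simpa using by exact_mod_cast (by positivity : ((n : ℝ) + 2) ≠ 0)
  refine htend.frequently (Filter.Frequently.of_forall fun n => hreal _ ⟨by positivity, ?_⟩)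
  rw [div_lt_one (by positivity)]
  linarith [(Nat.cast_nonneg n : (0 : ℝ) ≤ n)]

/-! ### Bateman's integral and the analytic continuation. -/

lemma continuousOn_comp_ofReal_mul {G : ℂ → ℂ} (hG : ContinuousOn G cutPlane) {z : ℂ}
    (hz : z ∈ cutPlane) : ContinuousOn (fun s : ℝ => G (s * z)) (Icc 0 1) :=
  hG.comp (by fun_prop) fun _ hs => ofReal_mul_mem_cutPlane hz hs

lemma aestronglyMeasurable_mul_comp_ofReal_mul {w : ℝ → ℂ} (hw : IntegrableOn w (Ioc 0 1))
    {G : ℂ → ℂ} (hG : ContinuousOn G cutPlane) {z : ℂ} (hz : z ∈ cutPlane) :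
    AEStronglyMeasurable (fun s : ℝ => w s * G (s * z)) (volume.restrict (Ioc 0 1)) :=
  hw.aestronglyMeasurable.mul
    (((continuousOn_comp_ofReal_mul hG hz).mono Ioc_subset_Icc_self).aestronglyMeasurable
      measurableSet_Ioc)

lemma integrableOn_mul_comp_ofReal_mul {w : ℝ → ℂ} (hw : IntegrableOn w (Ioc 0 1))
    {G : ℂ → ℂ} (hG : ContinuousOn G cutPlane) {z : ℂ} (hz : z ∈ cutPlane) :
    IntegrableOn (fun s : ℝ => w s * G (s * z)) (Ioc 0 1) := by
  obtain ⟨M, hM⟩ := isCompact_Icc.exists_bound_of_continuousOn (continuousOn_comp_ofReal_mul hG hz)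
  refine Integrable.mono' (hw.norm.mul_const M)
    (aestronglyMeasurable_mul_comp_ofReal_mul hw hG hz) ?_
  filter_upwards [ae_restrict_mem measurableSet_Ioc] with s hs
  rw [norm_mul]
  exact mul_le_mul_of_nonneg_left (hM s (Ioc_subset_Icc_self hs)) (norm_nonneg _)

/-- Differentiation under the integral. As the cut plane is star-shaped about `0`, the points `s z`
stay in it, and the derivative is bounded on `[0,1]` times a small closed ball, so the integrable
`w` dominates. -/
lemma differentiableOn_integral_mul_comp_ofReal_mul {w : ℝ → ℂ} (hw : IntegrableOn w (Ioc 0 1))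
    {G : ℂ → ℂ} (hG : DifferentiableOn ℂ G cutPlane) :
    DifferentiableOn ℂ (fun z => ∫ s in Ioc (0 : ℝ) 1, w s * G (s * z)) cutPlane := by
  intro z₀ hz₀
  have hG' : ContinuousOn (deriv G) cutPlane := (hG.deriv isOpen_cutPlane).continuousOn
  obtain ⟨ε, hε, hball⟩ := Metric.nhds_basis_closedBall.mem_iff.1 (isOpen_cutPlane.mem_nhds hz₀)
  have hK : IsCompact (Icc (0 : ℝ) 1 ×ˢ Metric.closedBall z₀ ε) :=
    isCompact_Icc.prod (isCompact_closedBall z₀ ε)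
  obtain ⟨M, hM⟩ := hK.exists_bound_of_continuousOn
    (f := fun p : ℝ × ℂ => (p.1 : ℂ) * deriv G (p.1 * p.2))
    ((by fun_prop : Continuous fun p : ℝ × ℂ => (p.1 : ℂ)).continuousOn.mul
      (hG'.comp (by fun_prop) fun p hp => ofReal_mul_mem_cutPlane (hball hp.2) hp.1))
  have hmem : ∀ z ∈ Metric.closedBall z₀ ε, z ∈ cutPlane := fun z hz => hball hz
  have key := hasDerivAt_integral_of_dominated_loc_of_deriv_le (μ := volume.restrict (Ioc (0 : ℝ) 1))
    (F := fun z (s : ℝ) => w s * G (s * z))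
    (F' := fun z (s : ℝ) => w s * ((s : ℂ) * deriv G (s * z))) (x₀ := z₀)
    (bound := fun s => ‖w s‖ * M) (Metric.closedBall_mem_nhds z₀ hε)
    (Filter.mem_of_superset (isOpen_cutPlane.mem_nhds hz₀) fun z hz =>
      aestronglyMeasurable_mul_comp_ofReal_mul hw hG.continuousOn hz)
    (integrableOn_mul_comp_ofReal_mul hw hG.continuousOn hz₀) ?_ ?_ (hw.norm.mul_const M) ?_
  · exact key.2.differentiableAt.differentiableWithinAt
  · refine hw.aestronglyMeasurable.mul (ContinuousOn.aestronglyMeasurable ?_ measurableSet_Ioc)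
    exact (by fun_prop : Continuous fun s : ℝ => (s : ℂ)).continuousOn.mul
      ((continuousOn_comp_ofReal_mul hG' hz₀).mono Ioc_subset_Icc_self)
  · filter_upwards [ae_restrict_mem measurableSet_Ioc] with s hs z hz
    rw [norm_mul]
    exact mul_le_mul_of_nonneg_left (hM (s, z) ⟨Ioc_subset_Icc_self hs, hz⟩) (norm_nonneg _)
  · filter_upwards [ae_restrict_mem measurableSet_Ioc] with s hs z hz
    have hd := (hG.differentiableAt (isOpen_cutPlane.mem_nhds
      (ofReal_mul_mem_cutPlane (hmem z hz) (Ioc_subset_Icc_self hs)))).hasDerivAt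
    have hm : HasDerivAt (fun z : ℂ => (s : ℂ) * z) s z := by
      simpa using (hasDerivAt_id z).const_mul (s : ℂ)
    have := (hd.comp z hm).const_mul (w s)
    rwa [mul_comm (deriv G _)] at this

/-- The weight `s^{-1/2} (1-s)^{c-3/2}` of the Bateman integral. -/
noncomputable def batemanWeight (c : ℂ) (s : ℝ) : ℂ :=
  (s : ℂ) ^ ((1 / 2 : ℂ) - 1) * (1 - (s : ℂ)) ^ (c - 1 / 2 - 1)

lemma integrableOn_batemanWeight {c : ℂ} (hc : 1 / 2 < c.re) :
    IntegrableOn (batemanWeight c) (Ioc 0 1) := by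
  have := Complex.betaIntegral_convergent (u := 1 / 2) (v := c - 1 / 2) (by norm_num)
    (by norm_num; linarith)
  rwa [intervalIntegrable_iff_integrableOn_Ioc_of_le zero_le_one] at this

lemma integral_batemanWeight_mul_pow {c : ℂ} (hc : 1 / 2 < c.re) (n : ℕ) :
    ∫ s in Ioc (0 : ℝ) 1, batemanWeight c s * (s : ℂ) ^ n =
      Complex.Gamma (1 / 2 + n) * Complex.Gamma (c - 1 / 2) / Complex.Gamma (c + n) := by
  have hn : (0 : ℝ) ≤ n := Nat.cast_nonneg n
  have hG := Complex.Gamma_mul_Gamma_eq_betaIntegral (s := 1 / 2 + n) (t := c - 1 / 2)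
    (by norm_num; linarith) (by norm_num; linarith)
  rw [show (1 / 2 + n : ℂ) + (c - 1 / 2) = c + n by ring] at hG
  rw [hG, mul_div_cancel_left₀ _ (Complex.Gamma_ne_zero_of_re_pos (by simp; linarith)),
    Complex.betaIntegral, intervalIntegral.integral_of_le zero_le_one]
  refine setIntegral_congr_fun measurableSet_Ioc fun s hs => ?_
  have hs0 : (s : ℂ) ≠ 0 := by exact_mod_cast hs.1.ne'
  simp only [batemanWeight]
  rw [show (1 / 2 + n : ℂ) - 1 = (1 / 2 - 1) + n by ring, Complex.cpow_add _ _ hs0,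
    Complex.cpow_natCast]
  ring

/-- Averaging `z^n` against the Beta weight replaces `1/(1/2)_n` by `1/(c)_n`, because `Γ(c+n)/Γ(c)
= (c)_n`. -/
lemma hypergeometricCoefficient_eq_half {a b c : ℂ} (hc : 1 / 2 < c.re) (n : ℕ) :
    Complex.Gamma c / (Complex.Gamma (1 / 2) * Complex.Gamma (c - 1 / 2)) *
      (ordinaryHypergeometricCoefficient a b (1 / 2) n *
        (Complex.Gamma (1 / 2 + n) * Complex.Gamma (c - 1 / 2) / Complex.Gamma (c + n))) =
      ordinaryHypergeometricCoefficient a b c n := by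
  have hn : (0 : ℝ) ≤ n := Nat.cast_nonneg n
  have h1 : Complex.Gamma (1 / 2) ≠ 0 := Complex.Gamma_ne_zero_of_re_pos (by norm_num)
  have h2 : Complex.Gamma (c - 1 / 2) ≠ 0 :=
    Complex.Gamma_ne_zero_of_re_pos (by norm_num; linarith)
  have h3 : Complex.Gamma c ≠ 0 := Complex.Gamma_ne_zero_of_re_pos (by linarith)
  have h4 : Complex.Gamma (c + n) ≠ 0 := Complex.Gamma_ne_zero_of_re_pos (by simp; linarith)
  have h5 : Complex.Gamma (1 / 2 + n) ≠ 0 :=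
    Complex.Gamma_ne_zero_of_re_pos (by norm_num; linarith)
  have hpos : ∀ z : ℂ, 0 < z.re → ∀ k : ℕ, z ≠ -k := by
    rintro z hz k rfl
    have : (0 : ℝ) ≤ k := Nat.cast_nonneg k
    simp at hz
    linarith
  simp only [ordinaryHypergeometricCoefficient]
  rw [← Complex.Gamma_add_nat_div_Gamma_eq c (hpos c (by linarith)),
    ← Complex.Gamma_add_nat_div_Gamma_eq (1 / 2 : ℂ) (hpos _ (by norm_num))]
  generalize Complex.Gamma (c - 1 / 2) = A at *
  generalize Complex.Gamma (1 / 2 + n) = B at *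
  field_simp

lemma hasSum_integral_batemanWeight {c : ℂ} (hc : 1 / 2 < c.re) {g : ℕ → ℂ} {z : ℂ}
    (hg : Summable fun n => g n * z ^ n) :
    HasSum (fun n : ℕ => g n * (Complex.Gamma (1 / 2 + n) * Complex.Gamma (c - 1 / 2) /
      Complex.Gamma (c + n)) * z ^ n)
      (∫ s in Ioc (0 : ℝ) 1, batemanWeight c s * ∑' n, g n * ((s : ℂ) * z) ^ n) := by
  have hw := integrableOn_batemanWeight hc
  have hint : ∀ n : ℕ, Integrable (fun s : ℝ => batemanWeight c s * (g n * ((s : ℂ) * z) ^ n))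
      (volume.restrict (Ioc 0 1)) := fun n =>
    hw.mul_continuousOn_of_subset (by fun_prop) measurableSet_Ioc isCompact_Icc Ioc_subset_Icc_self
  have hsum : Summable fun n : ℕ =>
      ∫ s in Ioc (0 : ℝ) 1, ‖batemanWeight c s * (g n * ((s : ℂ) * z) ^ n)‖ := by
    refine Summable.of_nonneg_of_le (fun n => integral_nonneg fun _ => norm_nonneg _) (fun n => ?_)
      (hg.norm.mul_left (∫ s in Ioc (0 : ℝ) 1, ‖batemanWeight c s‖))
    rw [← integral_mul_const]
    refine setIntegral_mono_on (hint n).norm (hw.norm.mul_const _) measurableSet_Ioc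
      fun s hs => ?_
    rw [norm_mul, norm_mul, mul_pow, norm_mul, norm_mul]
    gcongr
    rw [norm_pow, Complex.norm_real, Real.norm_of_nonneg hs.1.le]
    exact mul_le_of_le_one_left (norm_nonneg _) (pow_le_one₀ hs.1.le hs.2)
  have := hasSum_integral_of_summable_integral_norm hint hsum
  simp_rw [tsum_mul_left] at this
  convert! this using 1
  ext n
  rw [← integral_batemanWeight_mul_pow hc, mul_assoc, mul_comm (∫ s in _, _), ← mul_assoc,
    ← integral_const_mul]
  refine setIntegral_congr_fun measurableSet_Ioc fun s hs => ?_
  simp only [mul_pow]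
  ring

/-- Bateman's integral for the Gauss hypergeometric function with `a + b = 1`, on the cut plane. -/
noncomputable def batemanIntegral (c : ℂ) (τ : ℝ) (z : ℂ) : ℂ :=
  Complex.Gamma c / (Complex.Gamma (1 / 2) * Complex.Gamma (c - 1 / 2)) *
    ∫ s in Ioc (0 : ℝ) 1, batemanWeight c s * coshDivCos τ (s * z)

lemma isGaussContinuation_batemanIntegral {a b c : ℂ} {τ : ℝ} (ha : NotNonposInt a)
    (hb : NotNonposInt b) (hab : a + b = 1) (hab' : a * b = 1 / 4 + (τ : ℂ) ^ 2)
    (hc : 1 / 2 < c.re) : IsGaussContinuation a b c (batemanIntegral c τ) := by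
  refine ⟨(differentiableOn_integral_mul_comp_ofReal_mul (integrableOn_batemanWeight hc)
    (differentiableOn_coshDivCos τ)).const_mul _, fun z hz => ?_⟩
  have h1 : NotNonposInt (1 / 2) := notNonposInt_of_re_pos (by norm_num)
  refine HasSum.unique ?_ (hasSum_hypergeometric ha hb
    (notNonposInt_of_re_pos (a := c) (by linarith)) hz)
  have hs := (hasSum_integral_batemanWeight hc (hasSum_hypergeometric ha hb h1 hz).summable).mul_left
    (Complex.Gamma c / (Complex.Gamma (1 / 2) * Complex.Gamma (c - 1 / 2)))
  convert! hs using 1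
  · ext n
    rw [← hypergeometricCoefficient_eq_half hc]
    ring
  · rw [batemanIntegral]
    congr 1
    refine setIntegral_congr_fun measurableSet_Ioc fun s hs => ?_
    have hsz : ‖(s : ℂ) * z‖ < 1 := by
      rw [norm_mul, Complex.norm_real, Real.norm_of_nonneg hs.1.le]
      exact (mul_le_of_le_one_left (norm_nonneg _) hs.2).trans_lt hz
    rw [coshDivCos_eq_hypergeometric ha hb hab hab' hsz,
      (hasSum_hypergeometric ha hb h1 hsz).tsum_eq]

/-- Uniqueness makes the choice in `gauss2F1` harmless: any explicit continuation computes it on the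
cut plane. -/
lemma IsGaussContinuation.eqOn {a b c : ℂ} {f g : ℂ → ℂ} (hf : IsGaussContinuation a b c f)
    (hg : IsGaussContinuation a b c g) : EqOn f g cutPlane := by
  refine (hf.1.analyticOnNhd isOpen_cutPlane).eqOn_of_preconnected_of_eventuallyEq
    (hg.1.analyticOnNhd isOpen_cutPlane) isPreconnected_cutPlane zero_mem_cutPlane ?_
  filter_upwards [Metric.ball_mem_nhds (0 : ℂ) one_pos] with z hz
  rw [hf.2 z (by simpa using hz), hg.2 z (by simpa using hz)]

lemma gauss2F1_eq_of_isGaussContinuation {a b c : ℂ} {f : ℂ → ℂ}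
    (hf : IsGaussContinuation a b c f) {z : ℂ} (hz : z ∈ cutPlane) : gauss2F1 a b c z = f z := by
  have h : ∃ f : ℂ → ℂ, IsGaussContinuation a b c f := ⟨f, hf⟩
  rw [gauss2F1, dif_pos h]
  exact h.choose_spec.eqOn hf hz

/-! ### The Mehler–Dirichlet integral. -/

/-- The kernel `(x - cosh u)_+^{-μ-1/2}` of the Mehler–Dirichlet integral. -/
noncomputable def mehlerKernel (μ : ℂ) (x u : ℝ) : ℂ :=
  if Real.cosh u < x then ((x - Real.cosh u : ℝ) : ℂ) ^ (-μ - 1 / 2) else 0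

lemma cosh_lt_iff_lt_arcosh {x u : ℝ} (hx : 1 < x) (hu : 0 < u) :
    Real.cosh u < x ↔ u < Real.arcosh x := by
  rw [← Real.arcosh_lt_arcosh (Real.cosh_pos u) (by linarith), Real.arcosh_cosh hu.le]

lemma mehlerKernel_eq_indicator {x : ℝ} (hx : 1 < x) (μ : ℂ) (f : ℝ → ℂ) {u : ℝ} (hu : 0 < u) :
    f u * mehlerKernel μ x u = (Ioo 0 (Real.arcosh x)).indicator
      (fun u => f u * ((x - Real.cosh u : ℝ) : ℂ) ^ (-μ - 1 / 2)) u := by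
  by_cases h : Real.cosh u < x
  · rw [mehlerKernel, if_pos h, indicator_of_mem]
    exact ⟨hu, (cosh_lt_iff_lt_arcosh hx hu).1 h⟩
  · rw [mehlerKernel, if_neg h, indicator_of_notMem, mul_zero]
    exact fun h' => h ((cosh_lt_iff_lt_arcosh hx hu).2 h'.2)

lemma setIntegral_mul_mehlerKernel {x : ℝ} (hx : 1 < x) (μ : ℂ) (f : ℝ → ℂ) :
    ∫ u in Ioi 0, f u * mehlerKernel μ x u = ∫ u in Ioo 0 (Real.arcosh x),
      f u * ((x - Real.cosh u : ℝ) : ℂ) ^ (-μ - 1 / 2) := by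
  rw [setIntegral_congr_fun measurableSet_Ioi
    (fun u hu => mehlerKernel_eq_indicator hx μ f hu), setIntegral_indicator measurableSet_Ioo]
  congr 2
  exact inter_eq_right.2 fun u hu => hu.1

lemma integrableOn_mul_mehlerKernel_iff {x : ℝ} (hx : 1 < x) (μ : ℂ) (f : ℝ → ℂ) :
    IntegrableOn (fun u => f u * mehlerKernel μ x u) (Ioi 0) ↔
    IntegrableOn (fun u => f u * ((x - Real.cosh u : ℝ) : ℂ) ^ (-μ - 1 / 2))
      (Ioo 0 (Real.arcosh x)) := by
  have heq : EqOn (fun u => f u * mehlerKernel μ x u) ((Ioo 0 (Real.arcosh x)).indicator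
      fun u => f u * ((x - Real.cosh u : ℝ) : ℂ) ^ (-μ - 1 / 2)) (Ioi 0) :=
    fun u hu => mehlerKernel_eq_indicator hx μ f hu
  rw [integrableOn_congr_fun heq measurableSet_Ioi,
    IntegrableOn, integrable_indicator_iff measurableSet_Ioo, IntegrableOn,
    Measure.restrict_restrict measurableSet_Ioo, inter_eq_left.2 fun u hu => hu.1]
  exact Iff.rfl

lemma cpow_neg_half_ofReal {r : ℝ} (hr : 0 < r) : (r : ℂ) ^ ((1 / 2 : ℂ) - 1) = ((√r)⁻¹ : ℝ) := by
  rw [show (1 / 2 : ℂ) - 1 = ((-(1 / 2) : ℝ) : ℂ) by push_cast; ring,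
    ← Complex.ofReal_cpow hr.le, Real.rpow_neg hr.le, ← Real.sqrt_eq_rpow]

lemma cosh_sub_one_eq (u : ℝ) : Real.cosh u - 1 = 2 * Real.sinh (u / 2) ^ 2 := by
  have h1 := Real.cosh_two_mul (u / 2)
  have h2 := Real.cosh_sq (u / 2)
  rw [mul_div_cancel₀ u two_ne_zero] at h1
  linarith

lemma div_cpow_ofReal {r y : ℝ} (hr : 0 ≤ r) (hy : 0 < y) (w : ℂ) :
    ((r / y : ℝ) : ℂ) ^ w = (r : ℂ) ^ w * (y : ℂ) ^ (-w) := by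
  rw [div_eq_mul_inv, Complex.ofReal_mul, Complex.mul_cpow_ofReal_nonneg hr (inv_pos.2 hy).le,
    Complex.cpow_neg, Complex.ofReal_inv, Complex.inv_cpow]
  rw [Complex.arg_ofReal_of_nonneg hy.le]
  exact Real.pi_pos.ne

lemma image_cosh_sub_one_div {x : ℝ} (hx : 1 < x) :
    (fun u => (Real.cosh u - 1) / (x - 1)) '' Ioo 0 (Real.arcosh x) = Ioo 0 1 := by
  have hy : 0 < x - 1 := by linarith
  ext s
  constructor
  · rintro ⟨u, hu, rfl⟩
    have h1 : 1 < Real.cosh u := Real.one_lt_cosh.2 hu.1.ne'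
    have h2 := (cosh_lt_iff_lt_arcosh hx hu.1).2 hu.2
    exact ⟨div_pos (by linarith) hy, (div_lt_one hy).2 (by linarith)⟩
  · intro hs
    have h1 : 1 < 1 + s * (x - 1) := by nlinarith [mul_pos hs.1 hy]
    have h2 : 1 + s * (x - 1) < x := by nlinarith [mul_lt_mul_of_pos_right hs.2 hy]
    refine ⟨Real.arcosh (1 + s * (x - 1)), ⟨Real.arcosh_pos h1,
      (Real.arcosh_lt_arcosh (by linarith) (by linarith)).2 h2⟩, ?_⟩
    simp only
    rw [Real.cosh_arcosh h1.le]
    field_simp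
    ring

/-- Under `s = (cosh u - 1)/(x - 1)` one has `s(1-x)/2 = -sinh²(u/2)` and `1 - s = (x - cosh u)/(x -
1)`. The factors `sinh(u/2) cosh(u/2)` of the Jacobian cancel against `s^{-1/2}` and the denominator
of `coshDivCos`, leaving `√2`. -/
lemma batemanWeight_comp_cosh {μ : ℂ} {τ x u : ℝ} (hx : 1 < x)
    (hu : u ∈ Ioo 0 (Real.arcosh x)) :
    |Real.sinh u / (x - 1)| • (batemanWeight (1 - μ) ((Real.cosh u - 1) / (x - 1)) *
      coshDivCos τ ((((Real.cosh u - 1) / (x - 1) : ℝ) : ℂ) * ((1 - x) / 2))) =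
    (√2 : ℝ) * ((x - 1 : ℝ) : ℂ) ^ μ *
      (Real.cos (τ * u) * ((x - Real.cosh u : ℝ) : ℂ) ^ (-μ - 1 / 2)) := by
  have hy : 0 < x - 1 := by linarith
  have hyC : ((x - 1 : ℝ) : ℂ) ≠ 0 := by exact_mod_cast hy.ne'
  have hlt := (cosh_lt_iff_lt_arcosh hx hu.1).2 hu.2
  have hsh : 0 < Real.sinh (u / 2) := Real.sinh_pos_iff.2 (by linarith [hu.1])
  have hch := Real.cosh_pos (u / 2)
  have hs2 : Real.sinh u = 2 * Real.sinh (u / 2) * Real.cosh (u / 2) := by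
    rw [← Real.sinh_two_mul, mul_div_cancel₀ u two_ne_zero]
  have harg : (((Real.cosh u - 1) / (x - 1) : ℝ) : ℂ) * ((1 - x) / 2) =
      -(Real.sinh (u / 2) : ℂ) ^ 2 := by
    have : (Real.cosh u - 1) / (x - 1) * ((1 - x) / 2) = -Real.sinh (u / 2) ^ 2 := by
      rw [cosh_sub_one_eq]; field_simp; ring
    exact_mod_cast this
  have hone : 1 - (((Real.cosh u - 1) / (x - 1) : ℝ) : ℂ) =
      (((x - Real.cosh u) / (x - 1) : ℝ) : ℂ) := by
    rw [← Complex.ofReal_one, ← Complex.ofReal_sub]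
    congr 1
    field_simp
    ring
  have hsq : √((Real.cosh u - 1) / (x - 1)) = √2 * Real.sinh (u / 2) / √(x - 1) := by
    rw [Real.sqrt_div' _ hy.le, cosh_sub_one_eq, Real.sqrt_mul zero_le_two, Real.sqrt_sq hsh.le]
  have hpos : 0 < (Real.cosh u - 1) / (x - 1) :=
    div_pos (by rw [cosh_sub_one_eq]; positivity) hy
  have hpow : ((x - 1 : ℝ) : ℂ) ^ (-(-μ - 1 / 2)) = ((x - 1 : ℝ) : ℂ) ^ μ * (√(x - 1) : ℝ) := by
    rw [show -(-μ - 1 / 2) = μ + ((1 / 2 : ℝ) : ℂ) by push_cast; ring, Complex.cpow_add _ _ hyC,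
      ← Complex.ofReal_cpow hy.le, ← Real.sqrt_eq_rpow]
  rw [harg, coshDivCos_neg_sinh_sq, batemanWeight, cpow_neg_half_ofReal hpos, hsq, hone,
    show (1 - μ) - 1 / 2 - 1 = -μ - 1 / 2 by ring, div_cpow_ofReal (by linarith) hy, hpow,
    abs_of_pos (div_pos (Real.sinh_pos_iff.2 hu.1) hy), hs2, Complex.real_smul]
  have hr : 2 * Real.sinh (u / 2) * Real.cosh (u / 2) / (x - 1) *
      (√2 * Real.sinh (u / 2) / √(x - 1))⁻¹ * √(x - 1) / Real.cosh (u / 2) = √2 := by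
    have e1 := Real.mul_self_sqrt hy.le
    have e2 := Real.mul_self_sqrt (zero_le_two (α := ℝ))
    have h3 : √(x - 1) ≠ 0 := (Real.sqrt_pos.2 hy).ne'
    field_simp
    nlinarith
  have hr' := congrArg (fun r : ℝ => (r : ℂ)) hr
  simp only [Complex.ofReal_mul, Complex.ofReal_div, Complex.ofReal_inv] at hr' ⊢
  linear_combination (((x - 1 : ℝ) : ℂ) ^ μ * (Real.cos (τ * u) *
    ((x - Real.cosh u : ℝ) : ℂ) ^ (-μ - 1 / 2))) * hr'

lemma injOn_cosh_sub_one_div {x : ℝ} (hx : 1 < x) :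
    InjOn (fun u => (Real.cosh u - 1) / (x - 1)) (Ioo 0 (Real.arcosh x)) := by
  intro u hu v hv huv
  have hy : x - 1 ≠ 0 := by linarith
  simp only at huv
  rw [div_left_inj' hy, sub_left_inj] at huv
  exact Real.cosh_injOn hu.1.le hv.1.le huv

lemma hasDerivWithinAt_cosh_sub_one_div (x u : ℝ) (s : Set ℝ) :
    HasDerivWithinAt (fun u => (Real.cosh u - 1) / (x - 1)) (Real.sinh u / (x - 1)) s u :=
  (((Real.hasDerivAt_cosh u).sub_const 1).div_const (x - 1)).hasDerivWithinAt

lemma one_sub_div_two_mem_cutPlane {x : ℝ} (hx : 1 < x) : ((1 : ℂ) - x) / 2 ∈ cutPlane := by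
  rw [mem_cutPlane_iff_slitPlane, show (1 : ℂ) - (1 - x) / 2 = (((1 + x) / 2 : ℝ) : ℂ) by
    push_cast; ring]
  exact Complex.ofReal_mem_slitPlane.2 (by linarith)

/-- Integrability is carried over from the Bateman integrand by the same substitution; the condition
on `Re μ` is that of the Beta weight at `s = 1`. -/
lemma integrableOn_cos_mul_mehlerKernel {μ : ℂ} (hμ : μ.re < 1 / 2) (τ : ℝ) {x : ℝ} (hx : 1 < x) :
    IntegrableOn (fun u => (Real.cos (τ * u) : ℂ) * mehlerKernel μ x u) (Ioi 0) := by
  rw [integrableOn_mul_mehlerKernel_iff hx μ (fun u => (Real.cos (τ * u) : ℂ))]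
  have h := (integrableOn_mul_comp_ofReal_mul (integrableOn_batemanWeight (c := 1 - μ)
    (by simp; linarith)) (differentiableOn_coshDivCos τ).continuousOn
    (one_sub_div_two_mem_cutPlane hx)).mono_set Ioo_subset_Ioc_self
  rw [← image_cosh_sub_one_div hx, integrableOn_image_iff_integrableOn_abs_deriv_smul
    measurableSet_Ioo (fun u _ => hasDerivWithinAt_cosh_sub_one_div x u _)
    (injOn_cosh_sub_one_div hx), integrableOn_congr_fun
    (fun u hu => batemanWeight_comp_cosh hx hu) measurableSet_Ioo] at h
  have hne : ((√2 : ℝ) : ℂ) * ((x - 1 : ℝ) : ℂ) ^ μ ≠ 0 := by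
    refine mul_ne_zero (by simp) ?_
    rw [Complex.cpow_ne_zero_iff]
    left
    exact_mod_cast (by linarith : x - 1 ≠ 0)
  refine (integrable_const_mul_iff (isUnit_iff_ne_zero.2 hne) _).1 h

lemma batemanIntegral_one_sub_div_two (μ : ℂ) (τ : ℝ) {x : ℝ} (hx : 1 < x) :
    batemanIntegral (1 - μ) τ ((1 - x) / 2) =
      Complex.Gamma (1 - μ) / (Complex.Gamma (1 / 2) * Complex.Gamma (1 / 2 - μ)) *
        ((√2 : ℝ) * ((x - 1 : ℝ) : ℂ) ^ μ *
          ∫ u in Ioi 0, (Real.cos (τ * u) : ℂ) * mehlerKernel μ x u) := by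
  rw [batemanIntegral, show 1 - μ - 1 / 2 = 1 / 2 - μ by ring,
    setIntegral_mul_mehlerKernel hx μ (fun u => (Real.cos (τ * u) : ℂ)),
    integral_Ioc_eq_integral_Ioo, ← image_cosh_sub_one_div hx,
    integral_image_eq_integral_abs_deriv_smul measurableSet_Ioo
      (fun u _ => hasDerivWithinAt_cosh_sub_one_div x u _) (injOn_cosh_sub_one_div hx),
    setIntegral_congr_fun measurableSet_Ioo (fun u hu => batemanWeight_comp_cosh hx hu),
    integral_const_mul]

theorem legendreP_eq_mehler {μ : ℂ} (hμ : μ.re < 1 / 2) (τ : ℝ) {x : ℝ} (hx : 1 < x) :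
    legendreP μ (Complex.I * τ - 1 / 2) x =
      (√(2 / Real.pi) : ℝ) / Complex.Gamma (1 / 2 - μ) * ((x ^ 2 - 1 : ℝ) : ℂ) ^ (μ / 2) *
        ∫ u in Ioi 0, (Real.cos (τ * u) : ℂ) * mehlerKernel μ x u := by
  have hy : 0 < x - 1 := by linarith
  have hyC : ((x - 1 : ℝ) : ℂ) ≠ 0 := by exact_mod_cast hy.ne'
  have hcont : IsGaussContinuation (-(Complex.I * τ - 1 / 2)) (1 + (Complex.I * τ - 1 / 2)) (1 - μ)
      (batemanIntegral (1 - μ) τ) := by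
    refine isGaussContinuation_batemanIntegral (notNonposInt_of_re_pos (by simp))
      (notNonposInt_of_re_pos (by norm_num)) (by ring) ?_ (by simp; linarith)
    linear_combination -(τ : ℂ) ^ 2 * Complex.I_sq
  rw [legendreP, gauss2F1_eq_of_isGaussContinuation hcont (one_sub_div_two_mem_cutPlane hx),
    batemanIntegral_one_sub_div_two μ τ hx]
  have hG : Complex.Gamma (1 - μ) ≠ 0 := Complex.Gamma_ne_zero_of_re_pos (by simp; linarith)
  have hG2 : Complex.Gamma (1 / 2 - μ) ≠ 0 :=
    Complex.Gamma_ne_zero_of_re_pos (by norm_num; linarith)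
  have hpi : Complex.Gamma (1 / 2) = (√Real.pi : ℝ) := by
    rw [Complex.Gamma_one_half_eq, Real.sqrt_eq_rpow, Complex.ofReal_cpow Real.pi_pos.le]
    norm_num
  have hpi0 : ((√Real.pi : ℝ) : ℂ) ≠ 0 := by exact_mod_cast (Real.sqrt_pos.2 Real.pi_pos).ne'
  -- The half powers of `(x+1)/(x-1)` from the definition and the full power of `x-1` from the
  -- substitution combine into `(x²-1)^{μ/2}`.
  have hpow : (((x + 1) / (x - 1) : ℝ) : ℂ) ^ (μ / 2) * ((x - 1 : ℝ) : ℂ) ^ μ =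
      ((x ^ 2 - 1 : ℝ) : ℂ) ^ (μ / 2) := by
    rw [div_cpow_ofReal (by linarith) hy, mul_assoc, ← Complex.cpow_add _ _ hyC,
      show -(μ / 2) + μ = μ / 2 by ring,
      ← Complex.mul_cpow_ofReal_nonneg (by linarith) hy.le, ← Complex.ofReal_mul]
    congr 2
    ring
  rw [← hpow, hpi, Real.sqrt_div zero_le_two]
  push_cast
  field_simp

/-! ### The integral over `x`. -/

section StieltjesTransform

variable {b c : ℝ}

lemma tendsto_sub_div_add_atTop (b c : ℝ) :
    Filter.Tendsto (fun x : ℝ => (x - c) / (x + b)) Filter.atTop (nhds 1) := by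
  have h : Filter.Tendsto (fun x : ℝ => 1 - (b + c) / (x + b)) Filter.atTop (nhds (1 - 0)) :=
    tendsto_const_nhds.sub (tendsto_const_nhds.div_atTop
      (Filter.tendsto_atTop_add_const_right _ _ Filter.tendsto_id))
  rw [sub_zero] at h
  refine h.congr' ?_
  filter_upwards [Filter.eventually_gt_atTop (-b)] with x hx
  have : x + b ≠ 0 := by linarith
  field_simp
  ring

lemma hasDerivAt_sub_div_add {x : ℝ} (hx : x + b ≠ 0) :
    HasDerivAt (fun x : ℝ => (x - c) / (x + b)) ((b + c) / (x + b) ^ 2) x := by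
  convert! ((hasDerivAt_id x).sub_const c).div ((hasDerivAt_id x).add_const b) hx using 1
  simp

/-- The integrand has an elementary primitive, a power of the Möbius quotient `(x-c)/(x+b)`. This
quotient runs from `0` to `1` on `(c,∞)`, so the integral is the constant factor alone. -/
lemma hasDerivAt_cpow_sub_div_add (hbc : 0 < b + c) {μ : ℂ} (hμ : μ.re < 1 / 2) {x : ℝ}
    (hx : c < x) :
    HasDerivAt (fun x : ℝ => (((x - c) / (x + b) : ℝ) : ℂ) ^ (1 / 2 - μ) /
      ((1 / 2 - μ) * (b + c)))
      (((x + b : ℝ) : ℂ) ^ (μ - 3 / 2) * ((x - c : ℝ) : ℂ) ^ (-μ - 1 / 2)) x := by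
  have hxb : 0 < x + b := by linarith
  have hxc : 0 < x - c := by linarith
  have hκ : (1 / 2 - μ) ≠ 0 := by
    intro h
    have := congrArg Complex.re h
    norm_num at this
    linarith
  have hbc' : (b + c : ℂ) ≠ 0 := by exact_mod_cast hbc.ne'
  have hxb' : ((x + b : ℝ) : ℂ) ≠ 0 := by exact_mod_cast hxb.ne'
  have h1 := (hasDerivAt_ofReal_cpow_const (div_pos hxc hxb).ne' hκ).scomp x
    (hasDerivAt_sub_div_add (c := c) hxb.ne')
  convert! h1.div_const ((1 / 2 - μ) * (b + c)) using 1
  rw [div_cpow_ofReal hxc.le hxb, Complex.real_smul,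
    show μ - 3 / 2 = -((1 / 2 - μ) - 1) - (2 : ℕ) by push_cast; ring, Complex.cpow_sub _ _ hxb',
    Complex.cpow_natCast, show 1 / 2 - μ - 1 = -μ - 1 / 2 by ring]
  push_cast at hxb' ⊢
  generalize ((x : ℂ) - c) ^ (-μ - 1 / 2) = X
  generalize ((x : ℂ) + b) ^ (-(-μ - 1 / 2)) = Y
  generalize 1 / 2 - μ = κ at hκ ⊢
  field_simp

lemma hasDerivAt_rpow_sub_div_add (hbc : 0 < b + c) {σ : ℝ} (hσ : σ < 1 / 2) {x : ℝ}
    (hx : c < x) :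
    HasDerivAt (fun x : ℝ => ((x - c) / (x + b)) ^ (1 / 2 - σ) / ((1 / 2 - σ) * (b + c)))
      ((x + b) ^ (σ - 3 / 2) * (x - c) ^ (-σ - 1 / 2)) x := by
  have hxb : 0 < x + b := by linarith
  have hxc : 0 < x - c := by linarith
  have hκ : (1 / 2 - σ) ≠ 0 := by linarith
  have h1 := (hasDerivAt_sub_div_add (c := c) hxb.ne').rpow_const (p := 1 / 2 - σ)
    (Or.inl (div_pos hxc hxb).ne')
  convert! h1.div_const ((1 / 2 - σ) * (b + c)) using 1
  rw [Real.div_rpow hxc.le hxb.le, div_eq_mul_inv ((x - c) ^ _), ← Real.rpow_neg hxb.le,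
    show σ - 3 / 2 = -((1 / 2 - σ) - 1) - (2 : ℕ) by push_cast; ring, Real.rpow_sub hxb,
    Real.rpow_natCast, show 1 / 2 - σ - 1 = -σ - 1 / 2 by ring]
  generalize (x - c) ^ (-σ - 1 / 2) = X
  generalize (x + b) ^ (-(-σ - 1 / 2)) = Y
  generalize 1 / 2 - σ = κ at hκ ⊢
  field_simp

lemma continuousWithinAt_rpow_sub_div_add (hbc : 0 < b + c) {σ : ℝ} (hσ : σ < 1 / 2) :
    ContinuousWithinAt
      (fun x : ℝ => ((x - c) / (x + b)) ^ (1 / 2 - σ) / ((1 / 2 - σ) * (b + c))) (Ici c) c := by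
  have h := (hasDerivAt_sub_div_add (b := b) (c := c) (x := c) (by linarith)).continuousAt
  exact ((h.rpow_const (Or.inr (by linarith))).div_const _).continuousWithinAt

lemma tendsto_rpow_sub_div_add (b c : ℝ) (σ : ℝ) :
    Filter.Tendsto (fun x : ℝ => ((x - c) / (x + b)) ^ (1 / 2 - σ) / ((1 / 2 - σ) * (b + c)))
      Filter.atTop (nhds (1 / ((1 / 2 - σ) * (b + c)))) := by
  have := (tendsto_sub_div_add_atTop b c).rpow_const (p := 1 / 2 - σ) (Or.inl one_ne_zero)
  rw [Real.one_rpow] at this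
  exact this.div_const _

/-- A nonnegative derivative whose primitive has a finite limit is integrable. With `σ = Re μ` this
is the norm of the complex integrand. -/
lemma integrableOn_rpow_mul_rpow (hbc : 0 < b + c) {σ : ℝ} (hσ : σ < 1 / 2) :
    IntegrableOn (fun x : ℝ => (x + b) ^ (σ - 3 / 2) * (x - c) ^ (-σ - 1 / 2)) (Ioi c) :=
  integrableOn_Ioi_deriv_of_nonneg (continuousWithinAt_rpow_sub_div_add hbc hσ)
    (fun _ hx => hasDerivAt_rpow_sub_div_add hbc hσ hx)
    (fun x hx => mul_nonneg (Real.rpow_nonneg (by linarith [mem_Ioi.1 hx]) _)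
      (Real.rpow_nonneg (by linarith [mem_Ioi.1 hx]) _))
    (tendsto_rpow_sub_div_add b c σ)

lemma integral_rpow_mul_rpow (hbc : 0 < b + c) {σ : ℝ} (hσ : σ < 1 / 2) :
    ∫ x in Ioi c, (x + b) ^ (σ - 3 / 2) * (x - c) ^ (-σ - 1 / 2) =
      1 / ((1 / 2 - σ) * (b + c)) := by
  rw [integral_Ioi_of_hasDerivAt_of_tendsto (continuousWithinAt_rpow_sub_div_add hbc hσ)
    (fun _ hx => hasDerivAt_rpow_sub_div_add hbc hσ hx) (integrableOn_rpow_mul_rpow hbc hσ)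
    (tendsto_rpow_sub_div_add b c σ), sub_self, zero_div, Real.zero_rpow (by linarith), zero_div,
    sub_zero]

lemma norm_cpow_mul_cpow (hbc : 0 < b + c) (μ : ℂ) {x : ℝ} (hx : c < x) :
    ‖((x + b : ℝ) : ℂ) ^ (μ - 3 / 2) * ((x - c : ℝ) : ℂ) ^ (-μ - 1 / 2)‖ =
      (x + b) ^ (μ.re - 3 / 2) * (x - c) ^ (-μ.re - 1 / 2) := by
  rw [norm_mul, Complex.norm_cpow_eq_rpow_re_of_pos (by linarith),
    Complex.norm_cpow_eq_rpow_re_of_pos (by linarith)]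
  norm_num

lemma integrableOn_cpow_mul_cpow (hbc : 0 < b + c) {μ : ℂ} (hμ : μ.re < 1 / 2) :
    IntegrableOn (fun x : ℝ => ((x + b : ℝ) : ℂ) ^ (μ - 3 / 2) *
      ((x - c : ℝ) : ℂ) ^ (-μ - 1 / 2)) (Ioi c) := by
  refine (integrableOn_rpow_mul_rpow hbc hμ).mono' ?_ ?_
  · exact Measurable.aestronglyMeasurable (by fun_prop)
  · filter_upwards [ae_restrict_mem measurableSet_Ioi] with x hx
    exact (norm_cpow_mul_cpow hbc μ hx).le

lemma integral_cpow_mul_cpow (hbc : 0 < b + c) {μ : ℂ} (hμ : μ.re < 1 / 2) :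
    ∫ x in Ioi c, ((x + b : ℝ) : ℂ) ^ (μ - 3 / 2) * ((x - c : ℝ) : ℂ) ^ (-μ - 1 / 2) =
      1 / ((1 / 2 - μ) * (b + c)) := by
  have hre : 0 < (1 / 2 - μ).re := by norm_num; linarith
  have hcont : ContinuousWithinAt (fun x : ℝ => (((x - c) / (x + b) : ℝ) : ℂ) ^ (1 / 2 - μ) /
      ((1 / 2 - μ) * (b + c))) (Ici c) c := by
    have h := (hasDerivAt_sub_div_add (b := b) (c := c) (x := c) (by linarith)).continuousAt
    have h2 := ContinuousAt.comp (g := fun r : ℝ => (r : ℂ) ^ (1 / 2 - μ)) (x := c)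
      (Complex.continuousAt_ofReal_cpow_const _ _ (Or.inl hre)) h
    exact (h2.div_const _).continuousWithinAt
  have htend : Filter.Tendsto (fun x : ℝ => (((x - c) / (x + b) : ℝ) : ℂ) ^ (1 / 2 - μ) /
      ((1 / 2 - μ) * (b + c))) Filter.atTop (nhds (1 / ((1 / 2 - μ) * (b + c)))) := by
    have h2 := (Complex.continuousAt_ofReal_cpow_const 1 (1 / 2 - μ) (Or.inr one_ne_zero)).tendsto.comp
      (tendsto_sub_div_add_atTop b c)
    rw [Complex.ofReal_one, Complex.one_cpow] at h2
    exact h2.div_const _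
  rw [integral_Ioi_of_hasDerivAt_of_tendsto hcont
    (fun _ hx => hasDerivAt_cpow_sub_div_add hbc hμ hx) (integrableOn_cpow_mul_cpow hbc hμ) htend,
    sub_self, zero_div, Complex.ofReal_zero, Complex.zero_cpow (fun h => by rw [h] at hre; simp at hre),
    zero_div, sub_zero]

end StieltjesTransform

/-! ### The cosine transform over `u`. -/

section Sigmoid

/-- The derivative of the sigmoid function. -/
noncomputable def logisticDensity (u : ℝ) : ℝ := Real.sigmoid u * (1 - Real.sigmoid u)

lemma logisticDensity_pos (u : ℝ) : 0 < logisticDensity u :=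
  mul_pos (Real.sigmoid_pos u) (by linarith [Real.sigmoid_lt_one u])

lemma logisticDensity_eq (u : ℝ) : logisticDensity u = 1 / (2 * (1 + Real.cosh u)) := by
  have h := Real.exp_pos u
  rw [logisticDensity, Real.sigmoid_def, Real.cosh_eq, Real.exp_neg]
  field_simp
  ring

lemma integrable_logisticDensity : Integrable logisticDensity := by
  have h := (integrableOn_image_iff_integrableOn_abs_deriv_smul MeasurableSet.univ
    (fun u _ => (Real.hasDerivAt_sigmoid u).hasDerivWithinAt) Real.sigmoid_injective.injOn
    (fun _ => (1 : ℝ))).1 (by rw [image_univ, Real.range_sigmoid]; simp)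
  rw [integrableOn_univ] at h
  refine h.congr (Filter.Eventually.of_forall fun u => ?_)
  simp only [smul_eq_mul, mul_one]
  exact abs_of_pos (logisticDensity_pos u)

/-- With `s = sigmoid u` one has `s/(1-s) = e^u`, and the integral becomes `B(1+iτ, 1-iτ) = Γ(1+iτ)
Γ(1-iτ)`, evaluated by the reflection formula. -/
lemma integral_exp_mul_logisticDensity {τ : ℝ} (hτ : τ ≠ 0) :
    ∫ u : ℝ, Complex.exp (Complex.I * τ * u) * logisticDensity u =
      Real.pi * τ / Real.sinh (Real.pi * τ) := by
  have hbeta : Complex.betaIntegral (1 + Complex.I * τ) (1 - Complex.I * τ) =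
      Real.pi * τ / Real.sinh (Real.pi * τ) := by
    have h1 := Complex.Gamma_mul_Gamma_eq_betaIntegral (s := 1 + Complex.I * τ)
      (t := 1 - Complex.I * τ) (by simp) (by simp)
    rw [show 1 + Complex.I * τ + (1 - Complex.I * τ) = ((1 : ℕ) : ℂ) + 1 by push_cast; ring,
      Complex.Gamma_nat_eq_factorial, Nat.factorial_one, Nat.cast_one, one_mul] at h1
    have hIτ : Complex.I * τ ≠ 0 := mul_ne_zero Complex.I_ne_zero (by exact_mod_cast hτ)
    rw [← h1, add_comm 1 (Complex.I * (τ : ℂ)), Complex.Gamma_add_one _ hIτ, mul_assoc,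
      Complex.Gamma_mul_Gamma_one_sub,
      show (Real.pi : ℂ) * (Complex.I * τ) = (Real.pi * τ) * Complex.I by ring, Complex.sin_mul_I]
    have hs : Complex.sinh (Real.pi * τ) ≠ 0 := by
      have : Real.sinh (Real.pi * τ) ≠ 0 := by
        rw [Ne, Real.sinh_eq_zero]
        exact mul_ne_zero Real.pi_ne_zero hτ
      exact_mod_cast this
    push_cast
    field_simp
  rw [← hbeta, Complex.betaIntegral, intervalIntegral.integral_of_le zero_le_one,
    integral_Ioc_eq_integral_Ioo, ← Real.range_sigmoid, ← image_univ,
    integral_image_eq_integral_abs_deriv_smul MeasurableSet.univ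
    (fun u _ => (Real.hasDerivAt_sigmoid u).hasDerivWithinAt) Real.sigmoid_injective.injOn,
    setIntegral_univ]
  congr 1
  ext u
  have hs := Real.sigmoid_pos u
  have hs' : 0 < 1 - Real.sigmoid u := by linarith [Real.sigmoid_lt_one u]
  have hlog : Real.log (Real.sigmoid u) - Real.log (1 - Real.sigmoid u) = u := by
    rw [← Real.log_div hs.ne' hs'.ne', ← Real.sigmoid_neg, ← Real.sigmoid_mul_rexp_neg,
      div_mul_cancel_left₀ hs.ne', ← Real.exp_neg, neg_neg, Real.log_exp]
  have e : ((Real.sigmoid u : ℝ) : ℂ) ^ (1 + Complex.I * τ - 1) *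
      (1 - (Real.sigmoid u : ℂ)) ^ (1 - Complex.I * τ - 1) = Complex.exp (Complex.I * τ * u) := by
    rw [← Complex.ofReal_one, ← Complex.ofReal_sub, Complex.ofReal_one,
      Complex.cpow_def_of_ne_zero (by exact_mod_cast hs.ne'),
      Complex.cpow_def_of_ne_zero (by exact_mod_cast hs'.ne'), ← Complex.exp_add,
      ← Complex.ofReal_log hs.le, ← Complex.ofReal_log hs'.le]
    congr 1
    nth_rw 3 [← hlog]
    push_cast
    ring
  rw [e, Complex.real_smul, mul_comm, logisticDensity, abs_of_pos (mul_pos hs hs')]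

/-- The difference of two shifted sigmoid functions. -/
lemma sigmoid_sub_sigmoid (u t : ℝ) :
    Real.sigmoid (u + t) - Real.sigmoid (u - t) = Real.sinh t / (Real.cosh u + Real.cosh t) := by
  have hu := Real.exp_pos u
  have ht := Real.exp_pos t
  rw [Real.sigmoid_def, Real.sigmoid_def, Real.cosh_eq, Real.cosh_eq, Real.sinh_eq,
    neg_add, neg_sub, Real.exp_add, Real.exp_sub, Real.exp_neg, Real.exp_neg]
  field_simp
  ring

lemma inv_cosh_add_cosh_le (u t : ℝ) :
    1 / (Real.cosh u + Real.cosh t) ≤ 2 * logisticDensity u := by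
  rw [logisticDensity_eq]
  have h1 := Real.one_le_cosh t
  have h2 := Real.one_le_cosh u
  rw [show 2 * (1 / (2 * (1 + Real.cosh u))) = 1 / (1 + Real.cosh u) by field_simp]
  exact one_div_le_one_div_of_le (by linarith) (by linarith)

lemma integrable_sinh_div_cosh_add_cosh (t : ℝ) :
    Integrable fun u : ℝ => Real.sinh t / (Real.cosh u + Real.cosh t) := by
  have hne : ∀ u : ℝ, Real.cosh u + Real.cosh t ≠ 0 := fun u =>
    (add_pos (Real.cosh_pos u) (Real.cosh_pos t)).ne'
  refine (integrable_logisticDensity.const_mul (|Real.sinh t| * 2)).mono'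
    (Continuous.aestronglyMeasurable (by fun_prop (disch := assumption))) ?_
  refine Filter.Eventually.of_forall fun u => ?_
  rw [Real.norm_eq_abs, abs_div, abs_of_pos (add_pos (Real.cosh_pos u) (Real.cosh_pos t)),
    div_eq_mul_one_div, mul_assoc]
  exact mul_le_mul_of_nonneg_left (inv_cosh_add_cosh_le u t) (abs_nonneg _)

lemma norm_exp_I_mul (τ u : ℝ) : ‖Complex.exp (Complex.I * τ * u)‖ = 1 := by
  rw [show Complex.I * τ * u = ((τ * u : ℝ) : ℂ) * Complex.I by push_cast; ring,
    Complex.norm_exp_ofReal_mul_I]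

lemma integrable_exp_mul_ofReal (τ : ℝ) {f : ℝ → ℝ} (hf : Integrable f) :
    Integrable fun u : ℝ => Complex.exp (Complex.I * τ * u) * (f u : ℂ) :=
  hf.ofReal.bdd_mul (c := 1) (by fun_prop)
    (Filter.Eventually.of_forall fun u => (norm_exp_I_mul τ u).le)

/-- The quotient is `sigmoid (u+t) - sigmoid (u-t)`. Integrating by parts turns it into shifted
logistic densities, whose transforms differ by the phases `e^{∓iτt}`; their difference produces the
sine. -/
lemma integral_exp_mul_sinh_div {τ : ℝ} (hτ : τ ≠ 0) (t : ℝ) :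
    ∫ u : ℝ, Complex.exp (Complex.I * τ * u) *
      ((Real.sinh t / (Real.cosh u + Real.cosh t) : ℝ) : ℂ) =
      ((2 * Real.pi * Real.sin (τ * t) / Real.sinh (Real.pi * τ) : ℝ) : ℂ) := by
  have hτC : (τ : ℂ) ≠ 0 := by exact_mod_cast hτ
  have hLp := integrable_logisticDensity.comp_add_right t
  have hLm := integrable_logisticDensity.comp_sub_right t
  have hφ' : ∀ u : ℝ, HasDerivAt
      (fun u => ((Real.sinh t / (Real.cosh u + Real.cosh t) : ℝ) : ℂ))
      ((logisticDensity (u + t) - logisticDensity (u - t) : ℝ) : ℂ) u := by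
    intro u
    apply HasDerivAt.ofReal_comp
    simp_rw [← sigmoid_sub_sigmoid]
    exact ((Real.hasDerivAt_sigmoid (u + t)).comp_add_const u t).sub
      ((Real.hasDerivAt_sigmoid (u - t)).comp_sub_const u t)
  have hexp : ∀ u : ℝ, HasDerivAt (fun u : ℝ => Complex.exp (Complex.I * τ * u) / (Complex.I * τ))
      (Complex.exp (Complex.I * τ * u)) u := by
    intro u
    have h1 : HasDerivAt (fun u : ℝ => Complex.I * τ * (u : ℂ)) (Complex.I * τ) u := by
      simpa using (Complex.ofRealCLM.hasDerivAt (x := u)).const_mul (Complex.I * τ : ℂ)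
    have := h1.cexp.div_const (Complex.I * τ)
    rwa [mul_div_cancel_right₀ _ (mul_ne_zero Complex.I_ne_zero hτC)] at this
  have hparts := integral_mul_deriv_eq_deriv_mul_of_integrable
    (fun u _ => hφ' u) (fun u _ => hexp u)
    ((integrable_exp_mul_ofReal τ (integrable_sinh_div_cosh_add_cosh t)).congr
      (Filter.Eventually.of_forall fun u => mul_comm _ _))
    (((integrable_exp_mul_ofReal τ (hLp.sub hLm)).div_const (Complex.I * τ)).congr
      (Filter.Eventually.of_forall fun u => by simp only [Pi.mul_apply, Pi.sub_apply]; ring))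
    (((integrable_exp_mul_ofReal τ (integrable_sinh_div_cosh_add_cosh t)).div_const
      (Complex.I * τ)).congr
      (Filter.Eventually.of_forall fun u => by simp only [Pi.mul_apply]; ring))
  have hshift : ∀ r : ℝ, ∫ u : ℝ, Complex.exp (Complex.I * τ * u) * logisticDensity (u + r) =
      Complex.exp (-(Complex.I * τ * r)) * (Real.pi * τ / Real.sinh (Real.pi * τ)) := by
    intro r
    rw [← integral_exp_mul_logisticDensity hτ, ← integral_const_mul,
      ← integral_add_right_eq_self (fun u : ℝ => Complex.exp (-(Complex.I * τ * r)) *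
        (Complex.exp (Complex.I * τ * u) * logisticDensity u)) r]
    congr 1
    ext u
    rw [← mul_assoc, ← Complex.exp_add]
    congr 2
    push_cast
    ring
  simp_rw [mul_comm (Complex.exp _)]
  rw [hparts]
  have hsplit : ∫ u : ℝ, ((logisticDensity (u + t) - logisticDensity (u - t) : ℝ) : ℂ) *
      (Complex.exp (Complex.I * τ * u) / (Complex.I * τ)) =
      ((Complex.exp (-(Complex.I * τ * t)) - Complex.exp (Complex.I * τ * t)) *
        (Real.pi * τ / Real.sinh (Real.pi * τ))) / (Complex.I * τ) := by
    have hm := hshift (-t)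
    simp only [← sub_eq_add_neg] at hm
    rw [sub_mul, hshift t |>.symm, show Complex.exp (Complex.I * τ * t) =
      Complex.exp (-(Complex.I * τ * ((-t : ℝ) : ℂ))) by push_cast; ring_nf, ← hm,
      ← integral_sub (integrable_exp_mul_ofReal τ hLp) (integrable_exp_mul_ofReal τ hLm),
      ← integral_div]
    congr 1
    ext u
    push_cast
    ring
  rw [hsplit]
  have hs : Complex.sinh (Real.pi * τ) ≠ 0 := by
    have : Real.sinh (Real.pi * τ) ≠ 0 := by
      rw [Ne, Real.sinh_eq_zero]
      exact mul_ne_zero Real.pi_ne_zero hτ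
    exact_mod_cast this
  have hsin := Complex.two_sin (τ * t)
  rw [show -(τ * t : ℂ) * Complex.I = -(Complex.I * τ * t) by ring,
    show (τ * t : ℂ) * Complex.I = Complex.I * τ * t by ring] at hsin
  push_cast
  rw [show 2 * (Real.pi : ℂ) * Complex.sin (τ * t) = Real.pi * (2 * Complex.sin (τ * t)) by ring,
    hsin]
  have hI := Complex.I_ne_zero
  field_simp
  rw [Complex.I_sq]
  ring

/-- The cosine transform of `1 / (cosh u + cosh t)`. -/
theorem integral_cos_mul_sinh_div {τ : ℝ} (hτ : τ ≠ 0) (t : ℝ) :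
    ∫ u in Ioi (0 : ℝ), Real.cos (τ * u) * (Real.sinh t / (Real.cosh u + Real.cosh t)) =
      Real.pi * Real.sin (τ * t) / Real.sinh (Real.pi * τ) := by
  have hint := integrable_exp_mul_ofReal τ (integrable_sinh_div_cosh_add_cosh t)
  have h := congrArg Complex.re (integral_exp_mul_sinh_div hτ t)
  rw [Complex.ofReal_re, ← Complex.reCLM_apply, ← Complex.reCLM.integral_comp_comm hint] at h
  -- The real part is even in `u`, so the whole line counts the half line twice.
  have habs := integral_comp_abs
    (f := fun u => Real.cos (τ * u) * (Real.sinh t / (Real.cosh u + Real.cosh t)))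
  have heq : (fun u : ℝ => Complex.reCLM (Complex.exp (Complex.I * τ * u) *
      ((Real.sinh t / (Real.cosh u + Real.cosh t) : ℝ) : ℂ))) =
      fun u : ℝ => Real.cos (τ * |u|) * (Real.sinh t / (Real.cosh |u| + Real.cosh t)) := by
    ext u
    rw [Complex.reCLM_apply, Complex.re_mul_ofReal, Real.cosh_abs,
      show Complex.I * τ * u = ((τ * u : ℝ) : ℂ) * Complex.I by push_cast; ring,
      Complex.exp_ofReal_mul_I_re]
    congr 1
    rcases abs_choice u with hu | hu <;> rw [hu]
    rw [mul_neg, Real.cos_neg]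
  rw [heq, habs] at h
  linear_combination h / 2

end Sigmoid

/-! ### Fubini for the product kernel and orthogonality of sines. -/

section MehlerStieltjes

/-- For fixed `u` the cutoff restricts `x` to `(cosh u, ∞)`, a subset of `(1,∞)`; this is where the
formula for the integral over `x` applies. -/
lemma mul_mehlerKernel_eq_indicator (μ : ℂ) (f : ℝ → ℂ) (u x : ℝ) :
    f x * mehlerKernel μ x u = (Ioi (Real.cosh u)).indicator
      (fun x => f x * ((x - Real.cosh u : ℝ) : ℂ) ^ (-μ - 1 / 2)) x := by
  by_cases h : Real.cosh u < x
  · rw [mehlerKernel, if_pos h, indicator_of_mem (mem_Ioi.2 h)]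
  · rw [mehlerKernel, if_neg h, indicator_of_notMem (by simpa using h), mul_zero]

lemma integrableOn_cpow_mul_mehlerKernel {μ : ℂ} (hμ : μ.re < 1 / 2) (t u : ℝ) :
    IntegrableOn (fun x => ((x + Real.cosh t : ℝ) : ℂ) ^ (μ - 3 / 2) * mehlerKernel μ x u)
      (Ioi 1) := by
  simp_rw [mul_mehlerKernel_eq_indicator μ (fun x => ((x + Real.cosh t : ℝ) : ℂ) ^ (μ - 3 / 2))]
  rw [IntegrableOn, integrable_indicator_iff measurableSet_Ioi, IntegrableOn,
    Measure.restrict_restrict measurableSet_Ioi,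
    inter_eq_left.2 (Ioi_subset_Ioi (Real.one_le_cosh u))]
  exact integrableOn_cpow_mul_cpow (add_pos (Real.cosh_pos t) (Real.cosh_pos u)) hμ

lemma integral_cpow_mul_mehlerKernel {μ : ℂ} (hμ : μ.re < 1 / 2) (t u : ℝ) :
    ∫ x in Ioi 1, ((x + Real.cosh t : ℝ) : ℂ) ^ (μ - 3 / 2) * mehlerKernel μ x u =
      1 / ((1 / 2 - μ) * (Real.cosh t + Real.cosh u)) := by
  simp_rw [mul_mehlerKernel_eq_indicator μ (fun x => ((x + Real.cosh t : ℝ) : ℂ) ^ (μ - 3 / 2))]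
  rw [setIntegral_indicator measurableSet_Ioi,
    inter_eq_right.2 (Ioi_subset_Ioi (Real.one_le_cosh u)),
    integral_cpow_mul_cpow (add_pos (Real.cosh_pos t) (Real.cosh_pos u)) hμ]

lemma integral_norm_cpow_mul_mehlerKernel {μ : ℂ} (hμ : μ.re < 1 / 2) (t u : ℝ) :
    ∫ x in Ioi 1, ‖((x + Real.cosh t : ℝ) : ℂ) ^ (μ - 3 / 2) * mehlerKernel μ x u‖ =
      1 / ((1 / 2 - μ.re) * (Real.cosh t + Real.cosh u)) := by
  have hbc := add_pos (Real.cosh_pos t) (Real.cosh_pos u)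
  simp_rw [mul_mehlerKernel_eq_indicator μ (fun x => ((x + Real.cosh t : ℝ) : ℂ) ^ (μ - 3 / 2)),
    norm_indicator_eq_indicator_norm]
  rw [setIntegral_indicator measurableSet_Ioi,
    inter_eq_right.2 (Ioi_subset_Ioi (Real.one_le_cosh u)), ← integral_rpow_mul_rpow hbc hμ]
  exact setIntegral_congr_fun measurableSet_Ioi fun x hx => norm_cpow_mul_cpow hbc μ hx

/-- The integrand `p(t) sinh t (x + cosh t)^{μ-3/2} q(u) (x - cosh u)_+^{-μ-1/2}` whose integral
over `(t, u)` is a product of an incomplete and a complete Legendre function. -/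
noncomputable def legendreKernel (μ : ℂ) (p q : ℝ → ℝ) (z : ℝ × ℝ × ℝ) : ℂ :=
  (p z.2.1 * Real.sinh z.2.1 * ((z.1 + Real.cosh z.2.1 : ℝ) : ℂ) ^ (μ - 3 / 2)) *
    (q z.2.2 * mehlerKernel μ z.1 z.2.2)

lemma measurable_mehlerKernel (μ : ℂ) : Measurable fun z : ℝ × ℝ => mehlerKernel μ z.1 z.2 := by
  unfold mehlerKernel
  refine Measurable.ite (measurableSet_lt (by fun_prop) (by fun_prop)) (by fun_prop) (by fun_prop)

lemma measurable_legendreKernel (μ : ℂ) {p q : ℝ → ℝ} (hp : Measurable p) (hq : Measurable q) :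
    Measurable (legendreKernel μ p q) := by
  unfold legendreKernel
  have h1 : Measurable fun z : ℝ × ℝ × ℝ => mehlerKernel μ z.1 z.2.2 :=
    (measurable_mehlerKernel μ).comp (measurable_fst.prodMk (measurable_snd.comp measurable_snd))
  fun_prop

/-- The measure `dt du` on `(0, π] × (0, ∞)`. -/
noncomputable abbrev stripMeasure : Measure (ℝ × ℝ) :=
  (volume.restrict (Ioc 0 Real.pi)).prod (volume.restrict (Ioi 0))

lemma integrable_inv_cosh_add_cosh :
    Integrable (fun y : ℝ × ℝ => Real.sinh y.1 * (1 / (Real.cosh y.1 + Real.cosh y.2)))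
      stripMeasure := by
  have h1 : Integrable (fun t : ℝ => |Real.sinh t|) (volume.restrict (Ioc 0 Real.pi)) :=
    (Continuous.integrableOn_Icc (by fun_prop)).mono_set Ioc_subset_Icc_self
  have h2 : Integrable (fun u : ℝ => 2 * logisticDensity u) (volume.restrict (Ioi 0)) :=
    (integrable_logisticDensity.const_mul 2).integrableOn
  refine (h1.mul_prod h2).mono' (Measurable.aestronglyMeasurable (by fun_prop)) ?_
  refine Filter.Eventually.of_forall fun y => ?_
  rw [norm_mul, Real.norm_eq_abs, Real.norm_eq_abs, abs_of_pos (one_div_pos.2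
    (add_pos (Real.cosh_pos y.1) (Real.cosh_pos y.2))), add_comm]
  exact mul_le_mul_of_nonneg_left (inv_cosh_add_cosh_le _ _) (abs_nonneg _)

lemma legendreKernel_eq (μ : ℂ) (p q : ℝ → ℝ) (x : ℝ) (y : ℝ × ℝ) :
    legendreKernel μ p q (x, y) = (p y.1 * Real.sinh y.1 * q y.2 : ℝ) *
      (((x + Real.cosh y.1 : ℝ) : ℂ) ^ (μ - 3 / 2) * mehlerKernel μ x y.2) := by
  simp only [legendreKernel]
  push_cast
  ring

/-- Tonelli: integrating the norm over `x` leaves at most a constant times `|sinh t|/(cosh t + cosh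
u)`, integrable because `t` is bounded and the quotient decays in `u`. The factors `p`, `q` stay
general to cover both the trigonometric kernel and its majorant with `p = q = 1`. -/
lemma integrable_legendreKernel {μ : ℂ} (hμ : μ.re < 1 / 2) {p q : ℝ → ℝ} (hp : Measurable p)
    (hq : Measurable q) (hp1 : ∀ t, |p t| ≤ 1) (hq1 : ∀ u, |q u| ≤ 1) :
    Integrable (legendreKernel μ p q) ((volume.restrict (Ioi 1)).prod stripMeasure) := by
  rw [integrable_prod_iff' (measurable_legendreKernel μ hp hq).aestronglyMeasurable]
  refine ⟨Filter.Eventually.of_forall fun y => ?_, ?_⟩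
  · simp_rw [legendreKernel_eq]
    exact (integrableOn_cpow_mul_mehlerKernel hμ y.1 y.2).const_mul _
  · simp_rw [legendreKernel_eq, norm_mul (Complex.ofReal _), integral_const_mul,
      integral_norm_cpow_mul_mehlerKernel hμ]
    refine (integrable_inv_cosh_add_cosh.norm.const_mul (1 / (1 / 2 - μ.re))).mono'
      (Measurable.aestronglyMeasurable (by fun_prop)) (Filter.Eventually.of_forall fun y => ?_)
    have hσ : 0 < 1 / 2 - μ.re := by linarith
    have hc := add_pos (Real.cosh_pos y.1) (Real.cosh_pos y.2)
    rw [Complex.norm_real, norm_mul, norm_norm, norm_mul, norm_mul, norm_mul,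
      Real.norm_of_nonneg (by positivity : (0 : ℝ) ≤ 1 / ((1 / 2 - μ.re) * _)),
      Real.norm_of_nonneg (one_div_pos.2 hc).le, ← one_div_mul_one_div]
    have h1 : ‖p y.1‖ * ‖Real.sinh y.1‖ * ‖q y.2‖ ≤ ‖Real.sinh y.1‖ := by
      calc _ ≤ 1 * ‖Real.sinh y.1‖ * 1 := by
            gcongr
            · exact hp1 _
            · exact hq1 _
        _ = _ := by ring
    calc _ ≤ ‖Real.sinh y.1‖ * _ := mul_le_mul_of_nonneg_right h1 (by positivity)
      _ = _ := by ring

lemma integral_stripMeasure_legendreKernel (μ : ℂ) (p q : ℝ → ℝ) (x : ℝ) :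
    ∫ y, legendreKernel μ p q (x, y) ∂stripMeasure =
      (∫ t in Ioc 0 Real.pi,
        p t * Real.sinh t * ((x + Real.cosh t : ℝ) : ℂ) ^ (μ - 3 / 2)) *
        ∫ u in Ioi 0, q u * mehlerKernel μ x u :=
  integral_prod_mul (μ := volume.restrict (Ioc 0 Real.pi)) (ν := volume.restrict (Ioi 0))
    (fun t => p t * Real.sinh t * ((x + Real.cosh t : ℝ) : ℂ) ^ (μ - 3 / 2))
    (fun u => q u * mehlerKernel μ x u)

lemma integral_sin_mul_sin (n m : ℕ+) :
    ∫ t in Ioc 0 Real.pi, Real.sin (n * t) * Real.sin (m * t) =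
      if n = m then Real.pi / 2 else 0 := by
  have hint : ∀ k : ℝ, k ≠ 0 → ∫ t in (0 : ℝ)..Real.pi, Real.cos (k * t) =
      Real.sin (k * Real.pi) / k := by
    intro k hk
    rw [intervalIntegral.integral_comp_mul_left _ hk, integral_cos]
    simp
    field_simp
  have hprod : ∀ t : ℝ, Real.sin (n * t) * Real.sin (m * t) =
      (Real.cos (((n : ℝ) - m) * t) - Real.cos (((n : ℝ) + m) * t)) / 2 := by
    intro t
    rw [sub_mul, add_mul, Real.cos_sub, Real.cos_add]
    ring
  have hadd : (n : ℝ) + m ≠ 0 := by positivity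
  have hsin : Real.sin (((n : ℝ) + m) * Real.pi) = 0 := by
    exact_mod_cast Real.sin_nat_mul_pi (n + m : ℕ)
  rw [← intervalIntegral.integral_of_le Real.pi_pos.le]
  simp_rw [hprod]
  rw [intervalIntegral.integral_div, intervalIntegral.integral_sub
    (Continuous.intervalIntegrable (by fun_prop) _ _)
    (Continuous.intervalIntegrable (by fun_prop) _ _), hint _ hadd, hsin]
  split_ifs with h
  · subst h
    simp
  · have hsub : (n : ℝ) - m ≠ 0 := by
      rw [sub_ne_zero]
      exact_mod_cast h
    have hsin' : Real.sin (((n : ℝ) - m) * Real.pi) = 0 := by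
      exact_mod_cast Real.sin_int_mul_pi ((n : ℤ) - m)
    rw [hint _ hsub, hsin']
    simp

/-- Biorthogonality of the incomplete and the complete Legendre functions, up to normalization. -/
theorem integral_sin_mul_integral_cos {μ : ℂ} (hμ : μ.re < 1 / 2) (n m : ℕ+) :
    ∫ x in Ioi 1, (∫ t in Ioc 0 Real.pi,
        (Real.sin (n * t) : ℂ) * Real.sinh t * ((x + Real.cosh t : ℝ) : ℂ) ^ (μ - 3 / 2)) *
        ∫ u in Ioi 0, (Real.cos (m * u) : ℂ) * mehlerKernel μ x u =
      if n = m then (Real.pi : ℂ) ^ 2 / (2 * (1 / 2 - μ) * Real.sinh (Real.pi * m)) else 0 := by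
  set p : ℝ → ℝ := fun t => Real.sin (n * t)
  set q : ℝ → ℝ := fun u => Real.cos (m * u)
  have hF := integrable_legendreKernel hμ (p := p) (q := q) (by fun_prop) (by fun_prop)
    (fun t => Real.abs_sin_le_one _) (fun u => Real.abs_cos_le_one _)
  have hm : (m : ℝ) ≠ 0 := by positivity
  have hinner : ∀ y : ℝ × ℝ, ∫ x in Ioi 1, legendreKernel μ p q (x, y) =
      (1 / (1 / 2 - μ)) * ((p y.1 *
        (q y.2 * (Real.sinh y.1 / (Real.cosh y.2 + Real.cosh y.1))) : ℝ) : ℂ) := by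
    intro y
    simp_rw [legendreKernel_eq]
    rw [integral_const_mul, integral_cpow_mul_mehlerKernel hμ, add_comm (Complex.ofReal _)]
    push_cast
    rw [← one_div_mul_one_div]
    ring
  have hG := hF.integral_prod_right
  -- The product of the `t` and `u` integrals is one integral over the strip; the swap lets `x` be
  -- integrated before `u` and `t`.
  have hswap := integral_integral_swap (f := fun x y => legendreKernel μ p q (x, y)) hF
  simp_rw [integral_stripMeasure_legendreKernel] at hswap
  rw [hswap, integral_prod _ hG]
  simp_rw [hinner, integral_const_mul, integral_complex_ofReal, integral_const_mul, q,
    integral_cos_mul_sinh_div hm]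
  have : ∀ t : ℝ, p t * (Real.pi * Real.sin (m * t) / Real.sinh (Real.pi * m)) =
      Real.pi / Real.sinh (Real.pi * m) * (Real.sin (n * t) * Real.sin (m * t)) :=
    fun t => by ring
  simp_rw [this, integral_const_mul, integral_sin_mul_sin]
  split_ifs
  · push_cast
    rw [div_mul_div_comm, div_mul_div_comm]
    congr 1 <;> ring
  · simp

end MehlerStieltjes

/-! ### Biorthogonality and a majorant uniform in the order. -/

/-- Integration by parts with primitive `sin(nt)/n`. The boundary terms vanish because `n` is an
integer and the upper limit is `π`. The exponent drops to `μ - 3/2`; with `μ - 1/2` the integrand in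
`x` would decay only like `1/x`. -/
lemma incompleteLegendreP_eq {μ : ℂ} (hμ : μ.re < 1 / 2) (n : ℕ+) {x : ℝ} (hx : 1 < x) :
    incompleteLegendreP μ (Complex.I * (n : ℂ) - 1 / 2) x Real.pi =
      (√(2 / Real.pi) : ℝ) * Complex.Gamma (1 / 2 - μ) /
        (Complex.Gamma (1 / 2 + Complex.I * n - μ) * Complex.Gamma (1 / 2 - Complex.I * n - μ)) *
        ((1 / 2 - μ) / n) * ((x ^ 2 - 1 : ℝ) : ℂ) ^ (-(μ / 2)) *
        ∫ t in Ioc 0 Real.pi,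
          (Real.sin (n * t) : ℂ) * Real.sinh t * ((x + Real.cosh t : ℝ) : ℂ) ^ (μ - 3 / 2) := by
  have hn : (n : ℂ) ≠ 0 := by exact_mod_cast n.ne_zero
  have hκ : μ - 1 / 2 ≠ 0 := by
    intro h
    have := congrArg Complex.re h
    norm_num at this
    linarith
  have hpos : ∀ t : ℝ, 0 < x + Real.cosh t := fun t => by linarith [Real.cosh_pos t]
  have hderiv : ∀ t : ℝ, HasDerivAt (fun t : ℝ => ((x + Real.cosh t : ℝ) : ℂ) ^ (μ - 1 / 2))
      (Real.sinh t * ((μ - 1 / 2) * ((x + Real.cosh t : ℝ) : ℂ) ^ (μ - 3 / 2))) t := by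
    intro t
    have h1 := (hasDerivAt_ofReal_cpow_const (hpos t).ne' hκ).scomp t
      ((Real.hasDerivAt_cosh t).const_add x)
    rwa [Complex.real_smul, show μ - 1 / 2 - 1 = μ - 3 / 2 by ring] at h1
  have hsin : ∀ t : ℝ, HasDerivAt (fun t : ℝ => (Real.sin (n * t) : ℂ) / n)
      (Real.cos (n * t) : ℂ) t := by
    intro t
    have h1 : HasDerivAt (fun t : ℝ => Real.sin (n * t)) (Real.cos (n * t) * n) t := by
      simpa using ((hasDerivAt_id t).const_mul (n : ℝ)).sin
    have h2 := h1.ofReal_comp.div_const (n : ℂ)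
    rw [Complex.ofReal_mul, Complex.ofReal_natCast, mul_div_cancel_right₀ _ hn] at h2
    exact h2
  have hcont : ∀ w : ℂ, Continuous fun t : ℝ => ((x + Real.cosh t : ℝ) : ℂ) ^ w := fun w =>
    Continuous.cpow (by fun_prop) continuous_const
      fun t => Complex.ofReal_mem_slitPlane.2 (hpos t)
  have hparts := intervalIntegral.integral_mul_deriv_eq_deriv_mul (a := 0) (b := Real.pi)
    (fun t _ => hderiv t) (fun t _ => hsin t)
    (Continuous.intervalIntegrable (by have := hcont (μ - 3 / 2); fun_prop) _ _)
    (Continuous.intervalIntegrable (by fun_prop) _ _)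
  rw [show Real.sin (n * Real.pi) = 0 from Real.sin_nat_mul_pi n, mul_zero, Real.sin_zero,
    Complex.ofReal_zero, zero_div, mul_zero, mul_zero, sub_zero, zero_sub] at hparts
  have hlhs : (∫ t in (0 : ℝ)..Real.pi, Complex.cosh ((t : ℂ) *
      (Complex.I * (n : ℂ) - 1 / 2 + 1 / 2)) / ((Real.cosh t + x : ℝ) : ℂ) ^ (1 / 2 - μ)) =
      ∫ t in (0 : ℝ)..Real.pi, ((x + Real.cosh t : ℝ) : ℂ) ^ (μ - 1 / 2) *
        (Real.cos (n * t) : ℂ) := by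
    congr 1
    ext t
    rw [show (t : ℂ) * (Complex.I * (n : ℂ) - 1 / 2 + 1 / 2) = ((n * t : ℝ) : ℂ) * Complex.I by
      push_cast; ring, Complex.cosh_mul_I, ← Complex.ofReal_cos, add_comm (Real.cosh t),
      show μ - 1 / 2 = -(1 / 2 - μ) by ring, Complex.cpow_neg, div_eq_inv_mul]
  rw [incompleteLegendreP, hlhs, hparts, ← intervalIntegral.integral_of_le Real.pi_pos.le,
    show 1 + (Complex.I * (n : ℂ) - 1 / 2) - μ = 1 / 2 + Complex.I * n - μ by ring,
    show -(Complex.I * (n : ℂ) - 1 / 2) - μ = 1 / 2 - Complex.I * n - μ by ring,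
    show -μ / 2 = -(μ / 2) by ring]
  have hrw : (∫ t in (0 : ℝ)..Real.pi, (Real.sinh t : ℂ) * ((μ - 1 / 2) *
      ((x + Real.cosh t : ℝ) : ℂ) ^ (μ - 3 / 2)) * ((Real.sin (n * t) : ℂ) / n)) =
      (μ - 1 / 2) / n * ∫ t in (0 : ℝ)..Real.pi,
        (Real.sin (n * t) : ℂ) * Real.sinh t * ((x + Real.cosh t : ℝ) : ℂ) ^ (μ - 3 / 2) := by
    rw [← intervalIntegral.integral_const_mul]
    congr 1
    ext t
    ring
  rw [hrw]
  ring

lemma norm_integral_cos_mul_mehlerKernel_le {μ : ℂ} (hμ : μ.re < 1 / 2) (τ : ℝ) {x : ℝ}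
    (hx : 1 < x) :
    ‖∫ u in Ioi 0, (Real.cos (τ * u) : ℂ) * mehlerKernel μ x u‖ ≤
      ∫ u in Ioi 0, ‖mehlerKernel μ x u‖ := by
  have hK : IntegrableOn (mehlerKernel μ x) (Ioi 0) := by
    simpa using integrableOn_cos_mul_mehlerKernel hμ 0 hx
  refine norm_integral_le_of_norm_le hK.norm (Filter.Eventually.of_forall fun u => ?_)
  rw [norm_mul, Complex.norm_real]
  exact mul_le_of_le_one_left (norm_nonneg _) (Real.abs_cos_le_one _)

lemma legendreP_eq_mehler_pnat {μ : ℂ} (hμ : μ.re < 1 / 2) (m : ℕ+) {x : ℝ} (hx : 1 < x) :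
    legendreP μ (Complex.I * (m : ℂ) - 1 / 2) x =
      (√(2 / Real.pi) : ℝ) / Complex.Gamma (1 / 2 - μ) * ((x ^ 2 - 1 : ℝ) : ℂ) ^ (μ / 2) *
        ∫ u in Ioi 0, (Real.cos (m * u) : ℂ) * mehlerKernel μ x u := by
  rw [← legendreP_eq_mehler hμ (m : ℝ) hx, Complex.ofReal_natCast]

lemma summable_norm_mul_legendreP {μ : ℂ} (hμ : μ.re < 1 / 2) {a : ℕ+ → ℂ}
    (ha : Summable fun m : ℕ+ => ‖a m‖) {x : ℝ} (hx : 1 < x) :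
    Summable fun m : ℕ+ => ‖a m * legendreP μ (Complex.I * (m : ℂ) - 1 / 2) x‖ := by
  refine Summable.of_nonneg_of_le (fun _ => norm_nonneg _) (fun m => ?_)
    (ha.mul_right (‖(√(2 / Real.pi) : ℝ) / Complex.Gamma (1 / 2 - μ) *
      ((x ^ 2 - 1 : ℝ) : ℂ) ^ (μ / 2)‖ * ∫ u in Ioi 0, ‖mehlerKernel μ x u‖))
  rw [legendreP_eq_mehler_pnat hμ m hx, norm_mul, norm_mul _ (∫ u in Ioi 0, _)]
  gcongr
  exact norm_integral_cos_mul_mehlerKernel_le hμ m hx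

/-- The constant in the factorization of the product of an incomplete and a complete Legendre
function. -/
noncomputable def legendreProductConst (μ : ℂ) (n : ℕ+) : ℂ :=
  (2 / Real.pi) * ((1 / 2 - μ) / n) /
    (Complex.Gamma (1 / 2 + Complex.I * n - μ) * Complex.Gamma (1 / 2 - Complex.I * n - μ))

lemma incompleteLegendreP_mul_legendreP {μ : ℂ} (hμ : μ.re < 1 / 2) (n m : ℕ+) {x : ℝ}
    (hx : 1 < x) :
    incompleteLegendreP μ (Complex.I * (n : ℂ) - 1 / 2) x Real.pi *
        legendreP μ (Complex.I * (m : ℂ) - 1 / 2) x =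
      legendreProductConst μ n * ((∫ t in Ioc 0 Real.pi,
        (Real.sin (n * t) : ℂ) * Real.sinh t * ((x + Real.cosh t : ℝ) : ℂ) ^ (μ - 3 / 2)) *
        ∫ u in Ioi 0, (Real.cos (m * u) : ℂ) * mehlerKernel μ x u) := by
  have hx2 : ((x ^ 2 - 1 : ℝ) : ℂ) ≠ 0 := by
    exact_mod_cast (by nlinarith : (0 : ℝ) < x ^ 2 - 1).ne'
  have hpow : ((x ^ 2 - 1 : ℝ) : ℂ) ^ (-(μ / 2)) * ((x ^ 2 - 1 : ℝ) : ℂ) ^ (μ / 2) = 1 := by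
    rw [← Complex.cpow_add _ _ hx2, neg_add_cancel, Complex.cpow_zero]
  have hG : Complex.Gamma (1 / 2 - μ) * (Complex.Gamma (1 / 2 - μ))⁻¹ = 1 :=
    mul_inv_cancel₀ (Complex.Gamma_ne_zero_of_re_pos (by norm_num; linarith))
  have hsq : ((√(2 / Real.pi) : ℝ) : ℂ) * (√(2 / Real.pi) : ℝ) = 2 / Real.pi := by
    rw [← Complex.ofReal_mul, Real.mul_self_sqrt (by positivity)]
    push_cast
    rfl
  rw [incompleteLegendreP_eq hμ n hx, legendreP_eq_mehler_pnat hμ m hx, legendreProductConst,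
    ← hsq]
  generalize ((√(2 / Real.pi) : ℝ) : ℂ) = s
  generalize (∫ t in Ioc 0 Real.pi, (Real.sin (n * t) : ℂ) * Real.sinh t *
    ((x + Real.cosh t : ℝ) : ℂ) ^ (μ - 3 / 2)) = A
  generalize (∫ u in Ioi 0, (Real.cos (m * u) : ℂ) * mehlerKernel μ x u) = B
  generalize (Complex.Gamma (1 / 2 + Complex.I * n - μ) *
    Complex.Gamma (1 / 2 - Complex.I * n - μ)) = D
  calc _ = s * s * ((1 / 2 - μ) / n) / D * (A * B) *
        (Complex.Gamma (1 / 2 - μ) * (Complex.Gamma (1 / 2 - μ))⁻¹) *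
        (((x ^ 2 - 1 : ℝ) : ℂ) ^ (-(μ / 2)) * ((x ^ 2 - 1 : ℝ) : ℂ) ^ (μ / 2)) := by
          rw [div_eq_mul_inv s (Complex.Gamma (1 / 2 - μ))]; ring
    _ = _ := by rw [hG, hpow, mul_one, mul_one]

lemma integrableOn_incompleteLegendreP_mul_legendreP {μ : ℂ} (hμ : μ.re < 1 / 2) (n m : ℕ+) :
    IntegrableOn (fun x : ℝ => incompleteLegendreP μ (Complex.I * (n : ℂ) - 1 / 2) x Real.pi *
        legendreP μ (Complex.I * (m : ℂ) - 1 / 2) x) (Ioi 1) := by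
  have hF := integrable_legendreKernel hμ (p := fun t => Real.sin (n * t))
    (q := fun u => Real.cos (m * u)) (by fun_prop) (by fun_prop)
    (fun t => Real.abs_sin_le_one _) (fun u => Real.abs_cos_le_one _)
  have h := hF.integral_prod_left
  simp_rw [integral_stripMeasure_legendreKernel] at h
  exact (h.const_mul (legendreProductConst μ n)).congr
    ((ae_restrict_mem measurableSet_Ioi).mono fun x hx =>
      (incompleteLegendreP_mul_legendreP hμ n m hx).symm)

/-- An integrable majorant of the products of Legendre functions which does not depend on the
order of the complete one. -/
noncomputable def legendreMajorant (μ : ℂ) (n : ℕ+) (x : ℝ) : ℝ :=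
  ‖legendreProductConst μ n‖ *
    ∫ y, ‖legendreKernel μ (fun _ => 1) (fun _ => 1) (x, y)‖ ∂stripMeasure

lemma integrable_legendreKernel_one {μ : ℂ} (hμ : μ.re < 1 / 2) :
    Integrable (legendreKernel μ (fun _ => 1) (fun _ => 1))
      ((volume.restrict (Ioi 1)).prod stripMeasure) :=
  integrable_legendreKernel hμ (by fun_prop) (by fun_prop) (by simp) (by simp)

lemma integrableOn_legendreMajorant {μ : ℂ} (hμ : μ.re < 1 / 2) (n : ℕ+) :
    IntegrableOn (legendreMajorant μ n) (Ioi 1) :=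
  (integrable_legendreKernel_one hμ).integral_norm_prod_left.const_mul _

/-- Both trigonometric factors are at most `1` in absolute value. The exceptional null set comes
from the kernel with `p = q = 1` alone, so it serves all `m` at once. -/
lemma norm_incompleteLegendreP_mul_legendreP_le {μ : ℂ} (hμ : μ.re < 1 / 2) (n : ℕ+) :
    ∀ᵐ x ∂volume.restrict (Ioi (1 : ℝ)), ∀ m : ℕ+,
      ‖incompleteLegendreP μ (Complex.I * (n : ℂ) - 1 / 2) x Real.pi *
        legendreP μ (Complex.I * (m : ℂ) - 1 / 2) x‖ ≤ legendreMajorant μ n x := by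
  filter_upwards [(integrable_legendreKernel_one hμ).prod_right_ae,
    ae_restrict_mem measurableSet_Ioi] with x hint hx m
  have h := integral_stripMeasure_legendreKernel μ (fun t => Real.sin (n * t))
    (fun u => Real.cos (m * u)) x
  rw [incompleteLegendreP_mul_legendreP hμ n m hx, legendreMajorant, norm_mul, ← h]
  gcongr
  refine norm_integral_le_of_norm_le hint.norm (Filter.Eventually.of_forall fun y => ?_)
  simp only [legendreKernel_eq, norm_mul, Complex.norm_real, one_mul, mul_one]
  refine mul_le_mul_of_nonneg_right ?_ (by positivity)
  calc _ ≤ 1 * ‖Real.sinh y.1‖ * 1 := by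
        gcongr
        · exact Real.abs_sin_le_one _
        · exact Real.abs_cos_le_one _
    _ = _ := by ring

/-- Biorthogonality of the incomplete and the complete Legendre functions. -/
theorem integral_incompleteLegendreP_mul_legendreP {μ : ℂ} (hμ : μ.re < 1 / 2) (n m : ℕ+) :
    (n : ℂ) / (Real.pi : ℂ) * Complex.sinh ((Real.pi : ℂ) * (n : ℂ)) *
      Complex.Gamma (1 / 2 + Complex.I * (n : ℂ) - μ) *
      Complex.Gamma (1 / 2 - Complex.I * (n : ℂ) - μ) *
      ∫ x in Ioi (1 : ℝ), incompleteLegendreP μ (Complex.I * (n : ℂ) - 1 / 2) x Real.pi *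
        legendreP μ (Complex.I * (m : ℂ) - 1 / 2) x = if n = m then 1 else 0 := by
  rw [setIntegral_congr_fun measurableSet_Ioi
    (fun x hx => incompleteLegendreP_mul_legendreP hμ n m hx), integral_const_mul,
    integral_sin_mul_integral_cos hμ]
  split_ifs with h
  · subst h
    have hn : (n : ℂ) ≠ 0 := by exact_mod_cast n.ne_zero
    have hpi : (Real.pi : ℂ) ≠ 0 := by exact_mod_cast Real.pi_ne_zero
    have hκ : (1 / 2 - μ) ≠ 0 := by
      intro h
      have := congrArg Complex.re h
      norm_num at this
      linarith
    have hs : Complex.sinh ((Real.pi : ℂ) * (n : ℂ)) ≠ 0 := by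
      have : Real.sinh (Real.pi * n) ≠ 0 := by
        rw [Ne, Real.sinh_eq_zero]
        positivity
      exact_mod_cast this
    have h1 : Complex.Gamma (1 / 2 + Complex.I * (n : ℂ) - μ) ≠ 0 :=
      Complex.Gamma_ne_zero_of_re_pos (by simp; linarith)
    have h2 : Complex.Gamma (1 / 2 - Complex.I * (n : ℂ) - μ) ≠ 0 :=
      Complex.Gamma_ne_zero_of_re_pos (by simp; linarith)
    rw [legendreProductConst]
    push_cast
    generalize Complex.Gamma (1 / 2 + Complex.I * (n : ℂ) - μ) = G1 at *
    generalize Complex.Gamma (1 / 2 - Complex.I * (n : ℂ) - μ) = G2 at *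
    generalize 1 / 2 - μ = κ at *
    generalize Complex.sinh ((Real.pi : ℂ) * (n : ℂ)) = S at *
    field_simp
  · simp

/-! ### Termwise integration of the series. -/

theorem theorem1 (μ : ℂ) (hμ : μ.re < 1 / 2) (a : ℕ+ → ℂ)
    (ha : Summable fun m : ℕ+ => ‖a m‖) :
    (∀ x : ℝ, 1 < x →
      Summable fun m : ℕ+ => ‖a m * legendreP μ (Complex.I * (m : ℂ) - 1 / 2) x‖) ∧
    ∀ n : ℕ+,
      IntegrableOn
        (fun x : ℝ => ‖incompleteLegendreP μ (Complex.I * (n : ℂ) - 1 / 2) x Real.pi‖ *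
          ∑' m : ℕ+, ‖a m * legendreP μ (Complex.I * (m : ℂ) - 1 / 2) x‖) (Ioi 1) ∧
      IntegrableOn
        (fun x : ℝ => incompleteLegendreP μ (Complex.I * (n : ℂ) - 1 / 2) x Real.pi *
          ∑' m : ℕ+, a m * legendreP μ (Complex.I * (m : ℂ) - 1 / 2) x) (Ioi 1) ∧
      a n = (n : ℂ) / (Real.pi : ℂ) * Complex.sinh ((Real.pi : ℂ) * (n : ℂ)) *
          Complex.Gamma (1 / 2 + Complex.I * (n : ℂ) - μ) *
          Complex.Gamma (1 / 2 - Complex.I * (n : ℂ) - μ) *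
          ∫ x in Ioi (1 : ℝ),
            incompleteLegendreP μ (Complex.I * (n : ℂ) - 1 / 2) x Real.pi *
              ∑' m : ℕ+, a m * legendreP μ (Complex.I * (m : ℂ) - 1 / 2) x := by
  refine ⟨fun x hx => summable_norm_mul_legendreP hμ ha hx, fun n => ?_⟩
  set Q : ℝ → ℂ := fun x => incompleteLegendreP μ (Complex.I * (n : ℂ) - 1 / 2) x Real.pi with hQ
  set P : ℕ+ → ℝ → ℂ := fun m x => legendreP μ (Complex.I * (m : ℂ) - 1 / 2) x with hP
  have hint : ∀ m, Integrable (fun x => a m * (Q x * P m x)) (volume.restrict (Ioi 1)) :=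
    fun m => (integrableOn_incompleteLegendreP_mul_legendreP hμ n m).const_mul _
  have hbound : ∀ᵐ x ∂volume.restrict (Ioi (1 : ℝ)), ∀ m,
      ‖a m * (Q x * P m x)‖ ≤ ‖a m‖ * legendreMajorant μ n x := by
    filter_upwards [norm_incompleteLegendreP_mul_legendreP_le hμ n] with x hx m
    rw [norm_mul]
    exact mul_le_mul_of_nonneg_left (hx m) (norm_nonneg _)
  have hsum : ∀ᵐ x ∂volume.restrict (Ioi (1 : ℝ)), Summable fun m => ‖a m * (Q x * P m x)‖ := by
    filter_upwards [hbound] with x hx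
    exact Summable.of_nonneg_of_le (fun _ => norm_nonneg _) hx (ha.mul_right _)
  -- Multiplying a `tsum` by a scalar of a field needs no summability, so this and the next identity
  -- hold at every `x`.
  have hnorm : (fun x => ‖Q x‖ * ∑' m, ‖a m * P m x‖) =
      fun x => ∑' m, ‖a m * (Q x * P m x)‖ := by
    ext x
    rw [← tsum_mul_left]
    congr 1
    ext m
    rw [← norm_mul]
    congr 1
    ring
  have hmul : (fun x => Q x * ∑' m, a m * P m x) = fun x => ∑' m, a m * (Q x * P m x) := by
    ext x
    rw [← tsum_mul_left]
    congr 1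
    ext m
    ring
  have hmaj := (integrableOn_legendreMajorant hμ n).const_mul (∑' m, ‖a m‖)
  have hle : ∀ᵐ x ∂volume.restrict (Ioi (1 : ℝ)),
      ∑' m, ‖a m * (Q x * P m x)‖ ≤ (∑' m, ‖a m‖) * legendreMajorant μ n x := by
    filter_upwards [hbound, hsum] with x hx hs
    rw [← tsum_mul_right]
    exact hs.tsum_le_tsum hx (ha.mul_right _)
  refine ⟨?_, ?_, ?_⟩
  · rw [hnorm]
    -- The sum is measurable as an almost everywhere limit of finite partial sums, each of which is
    -- integrable.
    refine hmaj.mono' (aestronglyMeasurable_of_tendsto_ae Filter.atTop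
      (fun s : Finset ℕ+ => s.aestronglyMeasurable_fun_sum fun m _ => (hint m).1.norm)
      (hsum.mono fun x hx => hx.hasSum)) ?_
    filter_upwards [hle] with x hx
    rwa [Real.norm_of_nonneg (tsum_nonneg fun _ => norm_nonneg _)]
  · rw [hmul]
    refine hmaj.mono' (aestronglyMeasurable_of_tendsto_ae Filter.atTop
      (fun s : Finset ℕ+ => s.aestronglyMeasurable_fun_sum fun m _ => (hint m).1)
      (hsum.mono fun x hx => hx.of_norm.hasSum)) ?_
    filter_upwards [hle, hsum] with x hx hs
    exact (norm_tsum_le_tsum_norm hs).trans hx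
  · rw [hmul]
    have hsumint : Summable fun m => ∫ x in Ioi (1 : ℝ), ‖a m * (Q x * P m x)‖ := by
      refine Summable.of_nonneg_of_le (fun m => integral_nonneg fun _ => norm_nonneg _)
        (fun m => ?_) (ha.mul_right (∫ x in Ioi (1 : ℝ), legendreMajorant μ n x))
      rw [← integral_const_mul]
      exact integral_mono_ae (hint m).norm ((integrableOn_legendreMajorant hμ n).const_mul _)
        (hbound.mono fun x hx => hx m)
    rw [← integral_tsum_of_summable_integral_norm hint hsumint, ← tsum_mul_left]
    -- After the exchange of sum and integral, biorthogonality annihilates every term but `m = n`.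
    have hterm : ∀ m : ℕ+, (n : ℂ) / (Real.pi : ℂ) * Complex.sinh ((Real.pi : ℂ) * (n : ℂ)) *
          Complex.Gamma (1 / 2 + Complex.I * (n : ℂ) - μ) *
          Complex.Gamma (1 / 2 - Complex.I * (n : ℂ) - μ) *
          ∫ x in Ioi (1 : ℝ), a m * (Q x * P m x) = if m = n then a n else 0 := by
      intro m
      rw [integral_const_mul, mul_left_comm, integral_incompleteLegendreP_mul_legendreP hμ n m]
      rcases eq_or_ne m n with h | h
      · simp [h]
      · simp [h, h.symm]
    simp_rw [hterm]
    rw [tsum_ite_eq]
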